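/- Let $a,b>0$ be real numbers with $2a+b<2$, and let $L^2=L^2(-\pi,\pi)$ be the complex Hilbert space of square-integrable functions. Consider the following unbounded operators in $L^2$. * $L y=\big((1-a\cos x)\,y+b\sin x\cdot y'\big)'$, with domain consisting of all absolutely continuous functions $y$ on $[-\pi,\pi]$ with $y(-\pi)=y(\pi)$ such that $(1-a\cos x)y+b\sin x\cdot y'$ is (almost everywhere equal to) an absolutely continuous function on $[-\pi,\pi]$ whose derivative $Ly$ lies in $L^2$. * $S y=y'$, with domain consisting of all absolutely continuous functions $y$ on $[-\pi,\pi]$ with $y(-\pi)=y(\pi)$ and $y'\in L^2$. * $M y=(1-a\cos x)\,y+b\sin x\cdot y'$, with domain consisting of all $y\in L^2$ that are locally absolutely continuous on $(-\pi,0)\cup(0,\pi)$ and satisfy $My\in L^2$. Then $L$ is a closed operator with closed range, and $L=SM$, where the product has its natural domain $\{y\in\mathfrak D(M): My\in\mathfrak D(S)\}$. Moreover, $M$ is closed and boundedly invertible, i.e. $M$ is a bijection of $\mathfrak D(M)$ onto $L^2$ with bounded inverse. -/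

import Mathlib

open MeasureTheory Set
open scoped ENNReal

namespace FluidFactorization

/-- Lebesgue measure on the interval `(-π, π)`. -/
noncomputable abbrev mu : Measure ℝ := volume.restrict (Ioo (-Real.pi) Real.pi)

/-- The complex Hilbert space `L²(-π, π)`. -/
noncomputable abbrev H : Type := Lp ℂ 2 mu

/-- `f` is absolutely continuous on the closed interval `[-π, π]` and `f(-π) = f(π)`. -/
def PeriodicAC (f : ℝ → ℂ) : Prop :=
  AbsolutelyContinuousOnInterval f (-Real.pi) Real.pi ∧ f (-Real.pi) = f Real.pi

/-- The set `(-π, 0) ∪ (0, π)`. -/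
def punctured : Set ℝ := Ioo (-Real.pi) 0 ∪ Ioo 0 Real.pi

/-- `f` is absolutely continuous on every compact subinterval of `U`. -/
def LocallyACOn (f : ℝ → ℂ) (U : Set ℝ) : Prop :=
  ∀ c d : ℝ, c ≤ d → Icc c d ⊆ U → AbsolutelyContinuousOnInterval f c d

/-- The first-order differential expression `(1 - a cos x) f(x) + b sin x · f'(x)`. -/
noncomputable def flux (a b : ℝ) (f : ℝ → ℂ) (x : ℝ) : ℂ :=
  ((1 - a * Real.cos x : ℝ) : ℂ) * f x + ((b * Real.sin x : ℝ) : ℂ) * deriv f x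

/-! Elementary facts on absolutely continuous functions and their derivatives. -/

theorem ae_differentiable_of_ac {f : ℝ → ℂ}
    (hf : AbsolutelyContinuousOnInterval f (-Real.pi) Real.pi) :
    ∀ᵐ x ∂mu, DifferentiableAt ℝ f x := by
  rw [ae_restrict_iff' measurableSet_Ioo]
  filter_upwards [hf.boundedVariationOn.ae_differentiableAt_of_mem_uIcc] with x hx hmem
  refine hx ?_
  rw [uIcc_of_le (by linarith [Real.pi_pos])]
  exact Ioo_subset_Icc_self hmem

theorem ae_differentiable_of_locallyACOn_Ioo {f : ℝ → ℂ} {p q : ℝ}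
    (hf : LocallyACOn f (Ioo p q)) : ∀ᵐ x : ℝ, x ∈ Ioo p q → DifferentiableAt ℝ f x := by
  have h : ∀ c d : ℚ, ∀ᵐ x : ℝ, Icc (c : ℝ) d ⊆ Ioo p q → x ∈ Icc (c : ℝ) d →
      DifferentiableAt ℝ f x := by
    intro c d
    by_cases hcd : (c : ℝ) ≤ d ∧ Icc (c : ℝ) d ⊆ Ioo p q
    · have := (hf c d hcd.1 hcd.2).boundedVariationOn.ae_differentiableAt_of_mem_uIcc
      rw [uIcc_of_le hcd.1] at this
      filter_upwards [this] with x hx _ hm using hx hm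
    · refine Filter.Eventually.of_forall fun x h1 h2 => ?_
      exact absurd ⟨h2.1.trans h2.2, h1⟩ hcd
  have h' : ∀ᵐ x : ℝ, ∀ c d : ℚ, Icc (c : ℝ) d ⊆ Ioo p q → x ∈ Icc (c : ℝ) d →
      DifferentiableAt ℝ f x := ae_all_iff.2 fun c => ae_all_iff.2 fun d => h c d
  filter_upwards [h'] with x hx hm
  obtain ⟨c, hc1, hc2⟩ := exists_rat_btwn hm.1
  obtain ⟨d, hd1, hd2⟩ := exists_rat_btwn hm.2
  exact hx c d (fun z hz => ⟨hc1.trans_le hz.1, hz.2.trans_lt hd2⟩) ⟨hc2.le, hd1.le⟩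

theorem ae_mem_punctured : ∀ᵐ x ∂mu, x ∈ punctured := by
  rw [ae_restrict_iff' measurableSet_Ioo]
  have h0 : ∀ᵐ x : ℝ, x ≠ 0 := by simp [ae_iff, measure_singleton]
  filter_upwards [h0] with x hx hm
  rcases lt_or_gt_of_ne hx with h | h
  · exact Or.inl ⟨hm.1, h⟩
  · exact Or.inr ⟨h, hm.2⟩

theorem LocallyACOn.mono {f : ℝ → ℂ} {U V : Set ℝ} (hf : LocallyACOn f V) (h : U ⊆ V) :
    LocallyACOn f U := fun c d hcd hs => hf c d hcd (hs.trans h)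

theorem ae_differentiable_of_locallyACOn {f : ℝ → ℂ} (hf : LocallyACOn f punctured) :
    ∀ᵐ x ∂mu, DifferentiableAt ℝ f x := by
  filter_upwards [ae_mem_punctured,
    ae_restrict_of_ae (ae_differentiable_of_locallyACOn_Ioo (hf.mono subset_union_left)),
    ae_restrict_of_ae (ae_differentiable_of_locallyACOn_Ioo (hf.mono subset_union_right))]
    with x hx h1 h2
  exact hx.elim h1 h2

theorem LocallyACOn.continuousOn {f : ℝ → ℂ} {U : Set ℝ} (hU : IsOpen U)
    (hf : LocallyACOn f U) : ContinuousOn f U := by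
  intro x hx
  obtain ⟨e, he, hs⟩ := Metric.nhds_basis_closedBall.mem_iff.1 (hU.mem_nhds hx)
  rw [Real.closedBall_eq_Icc] at hs
  have hle : x - e ≤ x + e := by linarith
  have hc := (hf _ _ hle hs).continuousOn
  rw [uIcc_of_le hle] at hc
  exact (hc.continuousAt (Icc_mem_nhds (by linarith) (by linarith))).continuousWithinAt

theorem isOpen_punctured : IsOpen punctured := isOpen_Ioo.union isOpen_Ioo

theorem punctured_subset : punctured ⊆ Ioo (-Real.pi) Real.pi := by
  have := Real.pi_pos
  rintro x (h | h)
  · exact ⟨h.1, by linarith [h.2]⟩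
  · exact ⟨by linarith [h.1], h.2⟩

theorem ac_continuousOn_Ioo {f : ℝ → ℂ}
    (hf : AbsolutelyContinuousOnInterval f (-Real.pi) Real.pi) :
    ContinuousOn f (Ioo (-Real.pi) Real.pi) := by
  have hc := hf.continuousOn
  rw [uIcc_of_le (by linarith [Real.pi_pos])] at hc
  exact hc.mono Ioo_subset_Icc_self

theorem deriv_eq_zero_of_eqOn {f : ℝ → ℂ} {U : Set ℝ} (hU : IsOpen U)
    (h : EqOn f 0 U) {x : ℝ} (hx : x ∈ U) : deriv f x = 0 := by
  have : f =ᶠ[nhds x] (fun _ => (0 : ℂ)) := by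
    filter_upwards [hU.mem_nhds hx] with z hz using h hz
  rw [this.deriv_eq]
  simp

theorem deriv_ae_zero_of_ac {f : ℝ → ℂ}
    (hf : AbsolutelyContinuousOnInterval f (-Real.pi) Real.pi) (h0 : f =ᵐ[mu] 0) :
    EqOn f 0 (Ioo (-Real.pi) Real.pi) ∧ deriv f =ᵐ[mu] 0 := by
  have he : EqOn f 0 (Ioo (-Real.pi) Real.pi) :=
    Measure.eqOn_open_of_ae_eq (μ := (volume : Measure ℝ)) h0 isOpen_Ioo
      (ac_continuousOn_Ioo hf) continuousOn_const
  refine ⟨he, ?_⟩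
  filter_upwards [ae_restrict_mem (μ := (volume : Measure ℝ)) measurableSet_Ioo] with x hx
  exact deriv_eq_zero_of_eqOn isOpen_Ioo he hx

theorem flux_ae_zero {f : ℝ → ℂ} (a b : ℝ)
    (hf : LocallyACOn f punctured) (h0 : f =ᵐ[mu] 0) : flux a b f =ᵐ[mu] 0 := by
  have h0' : f =ᵐ[volume.restrict punctured] 0 :=
    ae_restrict_of_ae_restrict_of_subset punctured_subset h0
  have he : EqOn f 0 punctured :=
    Measure.eqOn_open_of_ae_eq h0' isOpen_punctured (hf.continuousOn isOpen_punctured)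
      continuousOn_const
  filter_upwards [ae_mem_punctured] with x hx
  simp [flux, he hx, deriv_eq_zero_of_eqOn isOpen_punctured he hx]

theorem PeriodicAC.locallyACOn {f : ℝ → ℂ} (hf : PeriodicAC f) : LocallyACOn f punctured := by
  intro c d hcd hs
  refine hf.1.mono ?_
  rw [uIcc_of_le hcd, uIcc_of_le (by linarith [Real.pi_pos])]
  exact (hs.trans punctured_subset).trans Ioo_subset_Icc_self

theorem flux_add {f g : ℝ → ℂ} (a b : ℝ) {x : ℝ} (hf : DifferentiableAt ℝ f x)
    (hg : DifferentiableAt ℝ g x) : flux a b (f + g) x = flux a b f x + flux a b g x := by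
  simp only [flux, deriv_add hf hg, Pi.add_apply]
  ring

theorem flux_smul {f : ℝ → ℂ} (a b : ℝ) (k : ℂ) (x : ℝ) :
    flux a b (k • f) x = k * flux a b f x := by
  simp only [flux, deriv_const_smul_field, Pi.smul_apply, smul_eq_mul]
  ring

theorem PeriodicAC.add {f g : ℝ → ℂ} (hf : PeriodicAC f) (hg : PeriodicAC g) :
    PeriodicAC (f + g) := ⟨hf.1.add hg.1, by simp [hf.2, hg.2]⟩

theorem PeriodicAC.smul {f : ℝ → ℂ} (k : ℂ) (hf : PeriodicAC f) : PeriodicAC (k • f) :=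
  ⟨hf.1.const_smul k, by simp [hf.2]⟩

theorem ac_zero (c d : ℝ) : AbsolutelyContinuousOnInterval (0 : ℝ → ℂ) c d :=
  (contDiff_zero_fun (n := 1) (𝕜 := ℝ)).contDiffOn.absolutelyContinuousOnInterval

theorem periodicAC_zero : PeriodicAC 0 := ⟨ac_zero _ _, rfl⟩

/-- The graph of `S`: pairs `(y, y')` where `y` has an absolutely continuous representative
on `[-π, π]` with equal end values and `y' ∈ L²`. -/
noncomputable def graphS : Submodule ℂ (H × H) where
  carrier := {p | ∃ f : ℝ → ℂ, PeriodicAC f ∧ (p.1 : ℝ → ℂ) =ᵐ[mu] f ∧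
    (p.2 : ℝ → ℂ) =ᵐ[mu] deriv f}
  zero_mem' := by
    refine ⟨0, periodicAC_zero, Lp.coeFn_zero _ _ _, (Lp.coeFn_zero _ _ _).trans ?_⟩
    exact Filter.Eventually.of_forall fun x => by simp [Pi.zero_def]
  add_mem' := by
    rintro p q ⟨f, hf, hf1, hf2⟩ ⟨g, hg, hg1, hg2⟩
    refine ⟨f + g, hf.add hg, (Lp.coeFn_add _ _).trans (hf1.add hg1),
      (Lp.coeFn_add _ _).trans ?_⟩
    filter_upwards [hf2, hg2, ae_differentiable_of_ac hf.1, ae_differentiable_of_ac hg.1]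
      with x h1 h2 h3 h4
    rw [deriv_add h3 h4, Pi.add_apply, h1, h2]
  smul_mem' := by
    rintro k p ⟨f, hf, hf1, hf2⟩
    refine ⟨k • f, hf.smul k, (Lp.coeFn_smul _ _).trans (hf1.const_smul k),
      (Lp.coeFn_smul _ _).trans ?_⟩
    filter_upwards [hf2] with x h1
    rw [deriv_const_smul_field, Pi.smul_apply, h1]

/-- The graph of `M`: pairs `(y, (1 - a cos x) y + b sin x · y')` of elements of `L²`, where `y` has
a representative that is locally absolutely continuous on `(-π, 0) ∪ (0, π)`. -/
noncomputable def graphM (a b : ℝ) : Submodule ℂ (H × H) where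
  carrier := {p | ∃ f : ℝ → ℂ, LocallyACOn f punctured ∧ (p.1 : ℝ → ℂ) =ᵐ[mu] f ∧
    (p.2 : ℝ → ℂ) =ᵐ[mu] flux a b f}
  zero_mem' := by
    refine ⟨0, fun c d _ _ => ac_zero c d, Lp.coeFn_zero _ _ _,
      (Lp.coeFn_zero _ _ _).trans ?_⟩
    exact Filter.Eventually.of_forall fun x => by simp [flux, Pi.zero_def]
  add_mem' := by
    rintro p q ⟨f, hf, hf1, hf2⟩ ⟨g, hg, hg1, hg2⟩
    refine ⟨f + g, fun c d h hs => (hf c d h hs).add (hg c d h hs),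
      (Lp.coeFn_add _ _).trans (hf1.add hg1), (Lp.coeFn_add _ _).trans ?_⟩
    filter_upwards [hf2, hg2, ae_differentiable_of_locallyACOn hf,
      ae_differentiable_of_locallyACOn hg] with x h1 h2 h3 h4
    rw [flux_add a b h3 h4, Pi.add_apply, h1, h2]
  smul_mem' := by
    rintro k p ⟨f, hf, hf1, hf2⟩
    refine ⟨k • f, fun c d h hs => (hf c d h hs).const_smul k,
      (Lp.coeFn_smul _ _).trans (hf1.const_smul k), (Lp.coeFn_smul _ _).trans ?_⟩
    filter_upwards [hf2] with x h1
    rw [flux_smul, Pi.smul_apply, h1, smul_eq_mul]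

/-- The graph of `L`: pairs `(y, ((1 - a cos x) y + b sin x · y')')` of elements of `L²`, where `y`
has an absolutely continuous representative on `[-π, π]` with equal end values, and
`(1 - a cos x) y + b sin x · y'` agrees almost everywhere with an absolutely continuous function
on `[-π, π]` (on which no boundary condition is imposed). -/
noncomputable def graphL (a b : ℝ) : Submodule ℂ (H × H) where
  carrier := {p | ∃ f F : ℝ → ℂ, PeriodicAC f ∧ (p.1 : ℝ → ℂ) =ᵐ[mu] f ∧
    AbsolutelyContinuousOnInterval F (-Real.pi) Real.pi ∧ F =ᵐ[mu] flux a b f ∧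
    (p.2 : ℝ → ℂ) =ᵐ[mu] deriv F}
  zero_mem' := by
    refine ⟨0, 0, periodicAC_zero, Lp.coeFn_zero _ _ _, ac_zero _ _, ?_,
      (Lp.coeFn_zero _ _ _).trans ?_⟩
    · exact Filter.Eventually.of_forall fun x => by simp [flux, Pi.zero_def]
    · exact Filter.Eventually.of_forall fun x => by simp [Pi.zero_def]
  add_mem' := by
    rintro p q ⟨f, F, hf, hf1, hF, hfF, hf2⟩ ⟨g, G, hg, hg1, hG, hgG, hg2⟩
    refine ⟨f + g, F + G, hf.add hg, (Lp.coeFn_add _ _).trans (hf1.add hg1), hF.add hG, ?_,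
      (Lp.coeFn_add _ _).trans ?_⟩
    · filter_upwards [hfF, hgG, ae_differentiable_of_ac hf.1, ae_differentiable_of_ac hg.1]
        with x h1 h2 h3 h4
      rw [flux_add a b h3 h4, Pi.add_apply, h1, h2]
    · filter_upwards [hf2, hg2, ae_differentiable_of_ac hF, ae_differentiable_of_ac hG]
        with x h1 h2 h3 h4
      rw [deriv_add h3 h4, Pi.add_apply, h1, h2]
  smul_mem' := by
    rintro k p ⟨f, F, hf, hf1, hF, hfF, hf2⟩
    refine ⟨k • f, k • F, hf.smul k, (Lp.coeFn_smul _ _).trans (hf1.const_smul k),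
      hF.const_smul k, ?_, (Lp.coeFn_smul _ _).trans ?_⟩
    · filter_upwards [hfF] with x h1
      rw [flux_smul, Pi.smul_apply, h1, smul_eq_mul]
    · filter_upwards [hf2] with x h1
      rw [deriv_const_smul_field, Pi.smul_apply, h1]

/-- The operator `S y = y'` with periodic boundary condition. -/
noncomputable def opS : H →ₗ.[ℂ] H := graphS.toLinearPMap

/-- The operator `M y = (1 - a cos x) y + b sin x · y'` on its maximal domain. -/
noncomputable def opM (a b : ℝ) : H →ₗ.[ℂ] H := (graphM a b).toLinearPMap

/-- The operator `L y = ((1 - a cos x) y + b sin x · y')'` with periodic domain. -/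
noncomputable def opL (a b : ℝ) : H →ₗ.[ℂ] H := (graphL a b).toLinearPMap

/-! The three sets of pairs are graphs of functions, so the operators just defined have exactly
these graphs. -/

theorem opS_graph : opS.graph = graphS := by
  refine Submodule.toLinearPMap_graph_eq _ ?_
  rintro p ⟨f, hf, h1, h2⟩ h0
  rw [h0] at h1
  have hz : f =ᵐ[mu] 0 := h1.symm.trans (Lp.coeFn_zero _ _ _)
  exact (Lp.eq_zero_iff_ae_eq_zero).2 (h2.trans (deriv_ae_zero_of_ac hf.1 hz).2)

theorem opM_graph (a b : ℝ) : (opM a b).graph = graphM a b := by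
  refine Submodule.toLinearPMap_graph_eq _ ?_
  rintro p ⟨f, hf, h1, h2⟩ h0
  rw [h0] at h1
  have hz : f =ᵐ[mu] 0 := h1.symm.trans (Lp.coeFn_zero _ _ _)
  exact (Lp.eq_zero_iff_ae_eq_zero).2 (h2.trans (flux_ae_zero a b hf hz))

theorem opL_graph (a b : ℝ) : (opL a b).graph = graphL a b := by
  refine Submodule.toLinearPMap_graph_eq _ ?_
  rintro p ⟨f, F, hf, h1, hF, hfF, h2⟩ h0
  rw [h0] at h1
  have hz : f =ᵐ[mu] 0 := h1.symm.trans (Lp.coeFn_zero _ _ _)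
  have hFz : F =ᵐ[mu] 0 := hfF.trans (flux_ae_zero a b hf.locallyACOn hz)
  exact (Lp.eq_zero_iff_ae_eq_zero).2 (h2.trans (deriv_ae_zero_of_ac hF hFz).2)

/-- The product `T ∘ R` of unbounded operators, with its natural domain
`{y ∈ 𝔇(R) | R y ∈ 𝔇(T)}`. -/
noncomputable def prodOp (T R : H →ₗ.[ℂ] H) : H →ₗ.[ℂ] H where
  domain := (T.domain.comap R.toFun).map R.domain.subtype
  toFun :=
    { toFun := fun y => T ⟨R ⟨y, by
          obtain ⟨_, z, _, hz⟩ := y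
          exact hz ▸ z.2⟩, by
          obtain ⟨_, z, hz', rfl⟩ := y
          exact hz'⟩
      map_add' := fun y z => by
        rw [← LinearPMap.map_add]
        congr 1
        exact Subtype.ext (LinearPMap.map_add R ⟨y, _⟩ ⟨z, _⟩)
      map_smul' := fun k y => by
        rw [RingHom.id_apply, ← LinearPMap.map_smul]
        congr 1
        exact Subtype.ext (LinearPMap.map_smul R k ⟨y, _⟩) }

/-- An unbounded operator is boundedly invertible if it is a bijection from its domain onto the
whole space whose inverse `B` is a bounded operator. -/
def BoundedlyInvertible (T : H →ₗ.[ℂ] H) : Prop :=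
  ∃ B : H →L[ℂ] H, (∀ u : H, ∃ h : B u ∈ T.domain, T ⟨B u, h⟩ = u) ∧
    ∀ y : T.domain, B (T y) = y

end FluidFactorization

/-! On each half of the punctured interval the equation `M y = g` is a scalar linear ODE, singular
at `0` and `±π`. Its homogeneous solution `homSol` behaves like `|x| ^ ((a - 1) / b)` at the origin.
Since `2 * a + b < 2`, this is not square integrable, so `M` is injective
(`eq_zero_of_flux_eq_zero`). For the same reason `varKer` is square integrable at `0`, so variation
of constants started at `0` makes sense. The resulting solution `varSol` is bounded in `L²` by an
energy estimate (`energy_bound`): multiply the equation by `y` and integrate, using `1 - (a + b / 2)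
cos x ≥ 1 - |a + b / 2| > 0`. Hence `M` has a bounded inverse `B`.

For `L = SM`, the inclusion `L ⊆ SM` needs the flux to inherit periodicity. It does, because the
term `b sin x · y'` has no boundary value at `±π` when `y'` is integrable (`flux_periodic`).
Conversely, if `F = M y` is periodic and `F'` is in `L²`, a periodic absolutely continuous solution
is sought as `F / (1 - a cos x) + sin x · z`. Then `z` solves an equation of the same type with `a -
b` in place of `a`, and the first part applies because `|a - b / 2| < 1`. Injectivity of `M`
identifies this solution with `y` (`mem_graphL_of_factor`).

Finally `S` is described by the integral functional `J` and the primitive operator `K`. The graph of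
`L` is thereby cut out by `J g = 0` and `y - B (K g) ∈ span {B 1}`, and its range is the kernel of
`J`; both sets are closed. -/

namespace FluidFactorization

/-! ### Absolutely continuous complex functions, and zeros forced by integrability -/

theorem ac_of_dist_le {X Y : Type*} [PseudoMetricSpace X] [PseudoMetricSpace Y]
    {f : ℝ → X} {g : ℝ → Y} {p q C : ℝ} (hC : 0 < C)
    (hg : AbsolutelyContinuousOnInterval g p q)
    (h : ∀ x ∈ uIcc p q, ∀ y ∈ uIcc p q, dist (f x) (f y) ≤ C * dist (g x) (g y)) :
    AbsolutelyContinuousOnInterval f p q := by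
  rw [absolutelyContinuousOnInterval_iff] at hg ⊢
  intro ε hε
  obtain ⟨δ, hδ, H⟩ := hg (ε / C) (by positivity)
  refine ⟨δ, hδ, fun E hE hs => ?_⟩
  have h1 := H E hE hs
  have hE' := hE.1
  calc _ ≤ ∑ i ∈ Finset.range E.1, C * dist (g (E.2 i).1) (g (E.2 i).2) :=
        Finset.sum_le_sum fun i hi => h _ (hE' i hi).1 _ (hE' i hi).2
    _ = C * ∑ i ∈ Finset.range E.1, dist (g (E.2 i).1) (g (E.2 i).2) := by
        rw [Finset.mul_sum]
    _ < C * (ε / C) := by gcongr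
    _ = ε := by field_simp

theorem ac_congr {X : Type*} [PseudoMetricSpace X] {f g : ℝ → X} {p q : ℝ}
    (hg : AbsolutelyContinuousOnInterval g p q) (h : EqOn f g (uIcc p q)) :
    AbsolutelyContinuousOnInterval f p q :=
  ac_of_dist_le one_pos hg fun x hx y hy => by rw [h hx, h hy, one_mul]

theorem ac_clm_comp {E F : Type*} [NormedAddCommGroup E] [NormedSpace ℝ E]
    [NormedAddCommGroup F] [NormedSpace ℝ F] (T : E →L[ℝ] F) {f : ℝ → E} {p q : ℝ}
    (hf : AbsolutelyContinuousOnInterval f p q) :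
    AbsolutelyContinuousOnInterval (fun x => T (f x)) p q := by
  refine ac_of_dist_le (C := ‖T‖ + 1) (by positivity) hf fun x _ y _ => ?_
  rw [dist_eq_norm, dist_eq_norm, ← map_sub]
  refine (T.le_opNorm _).trans ?_
  gcongr
  linarith

theorem ac_ofReal {f : ℝ → ℝ} {p q : ℝ} (hf : AbsolutelyContinuousOnInterval f p q) :
    AbsolutelyContinuousOnInterval (fun x => (f x : ℂ)) p q :=
  ac_clm_comp Complex.ofRealCLM hf

theorem ac_mul {f g : ℝ → ℂ} {p q : ℝ} (hf : AbsolutelyContinuousOnInterval f p q)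
    (hg : AbsolutelyContinuousOnInterval g p q) :
    AbsolutelyContinuousOnInterval (fun x => f x * g x) p q :=
  hf.smul hg

/-- Increments of the primitive of `f` are dominated by those of the primitive of `‖f‖`, which
reduces the claim to the real case. -/
theorem ac_intervalIntegral {f : ℝ → ℂ} {p q c : ℝ} (h : IntervalIntegrable f volume p q)
    (hc : c ∈ uIcc p q) : AbsolutelyContinuousOnInterval (fun x => ∫ v in c..x, f v) p q := by
  have hsub : ∀ x ∈ uIcc p q, ∀ y ∈ uIcc p q, IntervalIntegrable f volume x y :=
    fun x hx y hy => h.mono_set (uIcc_subset_uIcc hx hy)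
  refine ac_of_dist_le one_pos (h.norm.absolutelyContinuousOnInterval_intervalIntegral hc)
    fun x hx y hy => ?_
  rw [dist_eq_norm, dist_eq_norm, one_mul,
    intervalIntegral.integral_interval_sub_left (hsub c hc x hx) (hsub c hc y hy),
    intervalIntegral.integral_interval_sub_left (hsub c hc x hx).norm (hsub c hc y hy).norm,
    Real.norm_eq_abs]
  exact intervalIntegral.norm_integral_le_abs_integral_norm

theorem ac_ae_hasDerivAt {f : ℝ → ℂ} {p q : ℝ} (hf : AbsolutelyContinuousOnInterval f p q) :
    ∀ᵐ x, x ∈ uIcc p q → HasDerivAt f (deriv f x) x := by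
  filter_upwards [hf.boundedVariationOn.ae_differentiableAt_of_mem_uIcc] with x hx hm
  exact (hx hm).hasDerivAt

theorem ac_intervalIntegrable_deriv {f : ℝ → ℂ} {p q : ℝ}
    (hf : AbsolutelyContinuousOnInterval f p q) : IntervalIntegrable (deriv f) volume p q := by
  have hre := (ac_clm_comp Complex.reCLM hf).intervalIntegrable_deriv
  have him := (ac_clm_comp Complex.imCLM hf).intervalIntegrable_deriv
  have h : IntervalIntegrable (fun x => ((deriv (fun x => Complex.reCLM (f x)) x : ℝ) : ℂ) +
      ((deriv (fun x => Complex.imCLM (f x)) x : ℝ) : ℂ) * Complex.I) volume p q := by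
    refine IntervalIntegrable.add ?_ (IntervalIntegrable.mul_const ?_ _)
    · exact ⟨hre.1.ofReal, hre.2.ofReal⟩
    · exact ⟨him.1.ofReal, him.2.ofReal⟩
  refine h.congr_ae ?_
  rw [Filter.EventuallyEq, ae_restrict_iff' measurableSet_uIoc]
  filter_upwards [ac_ae_hasDerivAt hf] with x hx hm
  have hd := hx (uIoc_subset_uIcc hm)
  have h1 : HasDerivAt (fun x => Complex.reCLM (f x)) (Complex.reCLM (deriv f x)) x :=
    Complex.reCLM.hasFDerivAt.comp_hasDerivAt x hd
  have h2 : HasDerivAt (fun x => Complex.imCLM (f x)) (Complex.imCLM (deriv f x)) x :=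
    Complex.imCLM.hasFDerivAt.comp_hasDerivAt x hd
  rw [h1.deriv, h2.deriv]
  exact Complex.re_add_im _

/-- A function that is absolutely continuous is the primitive of its derivative. -/
theorem ac_eq_add_integral {f D : ℝ → ℂ} {p q : ℝ}
    (hf : AbsolutelyContinuousOnInterval f p q) (hD : IntervalIntegrable D volume p q)
    (h : ∀ᵐ x, x ∈ uIcc p q → deriv f x = D x) {x y : ℝ} (hx : x ∈ uIcc p q)
    (hy : y ∈ uIcc p q) : f y = f x + ∫ t in x..y, D t := by
  have hac : AbsolutelyContinuousOnInterval (fun y => f y - ∫ t in x..y, D t) p q :=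
    hf.sub (ac_intervalIntegral hD hx)
  obtain ⟨C, hC⟩ := hac.const_of_ae_hasDerivAt_zero (by
    filter_upwards [ac_ae_hasDerivAt hf, hD.ae_hasDerivAt_integral, h] with z h1 h2 h3 hz
    have := (h1 hz).sub (h2 hz x hx)
    rwa [h3 hz, sub_self] at this)
  have e1 := hC x hx
  have e2 := hC y hy
  simp only [intervalIntegral.integral_same, sub_zero] at e1
  rw [e1, ← e2]; ring

theorem locallyACOn_eq_add_integral {f D : ℝ → ℂ} {p q : ℝ} (hf : LocallyACOn f (Ioo p q))
    (hD : IntervalIntegrable D volume p q) (h : ∀ᵐ x, x ∈ Ioo p q → deriv f x = D x)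
    {x y : ℝ} (hx : x ∈ Ioo p q) (hy : y ∈ Ioo p q) : f y = f x + ∫ t in x..y, D t := by
  have hpq : p < q := hx.1.trans hx.2
  have hs : uIcc x y ⊆ Ioo p q := fun z hz =>
    ⟨(lt_min hx.1 hy.1).trans_le hz.1, hz.2.trans_lt (max_lt hx.2 hy.2)⟩
  have hac : AbsolutelyContinuousOnInterval f x y :=
    (hf _ _ min_le_max hs).mono (by rw [uIcc_of_le min_le_max, uIcc])
  refine ac_eq_add_integral hac (hD.mono_set ?_) ?_ left_mem_uIcc right_mem_uIcc
  · rw [uIcc_of_le hpq.le]; exact hs.trans Ioo_subset_Icc_self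
  · filter_upwards [h] with z hz hm using hz (hs hm)

/-- The function `1 / |x - c|` is not integrable at `c`. Both the injectivity of `M` and the
vanishing of boundary values rest on this. -/
theorem not_ae_inv_le {z : ℝ → ℝ} {C c d : ℝ} (hcd : c ≠ d)
    (hz : IntervalIntegrable z volume c d)
    (h : ∀ᵐ x, x ∈ uIoc c d → |x - c|⁻¹ ≤ C * z x) : False := by
  have : IntervalIntegrable (fun x => (x - c)⁻¹) volume c d := by
    refine (hz.const_mul C).mono_fun (by fun_prop) ?_
    rw [Filter.EventuallyLE, ae_restrict_iff' measurableSet_uIoc]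
    filter_upwards [h] with x hx hm
    rw [norm_inv, Real.norm_eq_abs]
    exact (hx hm).trans (le_abs_self _)
  rw [intervalIntegrable_sub_inv_iff] at this
  exact this.elim hcd fun h => h left_mem_uIcc

/-- If `z` is integrable and `H` is continuous with `‖H x‖ ≤ C |x - c| ‖z x‖` near `c`, then `H`
vanishes at `c`. -/
theorem eq_zero_of_norm_le_mul {H z : ℝ → ℂ} {C c d : ℝ} (hcd : c ≠ d)
    (hH : ContinuousWithinAt H (uIcc c d) c) (hz : IntervalIntegrable z volume c d)
    (h : ∀ᵐ x, x ∈ uIoo c d → ‖H x‖ ≤ C * |x - c| * ‖z x‖) : H c = 0 := by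
  by_contra hne
  have hpos : 0 < ‖H c‖ / 2 := by have := norm_pos_iff.2 hne; linarith
  have hev : ∀ᶠ x in nhdsWithin c (uIcc c d), ‖H c‖ / 2 < ‖H x‖ :=
    (hH.norm).eventually (lt_mem_nhds (by linarith))
  obtain ⟨r, hr, hb⟩ := Metric.mem_nhdsWithin_iff.1 hev
  -- Shrink to a segment from `c` on which `‖H‖` exceeds `‖H c‖ / 2`; there `1 / |x - c|` would be
  -- at most a constant times `‖z x‖`.
  obtain ⟨e, he, hs⟩ : ∃ e, c ≠ e ∧ uIcc c e ⊆ Metric.ball c r ∩ uIcc c d := by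
    have hcd' : 0 < |d - c| := abs_pos.2 (sub_ne_zero.2 hcd.symm)
    obtain ⟨t, ht0, ht⟩ : ∃ t : ℝ, 0 < t ∧ t < min 1 (r / |d - c|) :=
      exists_between (lt_min one_pos (by positivity))
    have ht1 : t < 1 := ht.trans_le (min_le_left _ _)
    have ht2 : t * |d - c| < r := (lt_div_iff₀ hcd').1 (ht.trans_le (min_le_right _ _))
    refine ⟨c + t * (d - c), ?_, ?_⟩
    · intro h
      have : t * (d - c) = 0 := by linarith
      rcases mul_eq_zero.1 this with h | h
      · exact ht0.ne' h
      · exact hcd (by linarith)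
    · have hmem : c + t * (d - c) ∈ uIcc c d := by
        rw [← segment_eq_uIcc]
        exact ⟨1 - t, t, by linarith, ht0.le, by ring, by simp; ring⟩
      have hball : c + t * (d - c) ∈ Metric.ball c r := by
        rw [Metric.mem_ball, Real.dist_eq]
        simpa [abs_mul, abs_of_pos ht0] using ht2
      refine subset_inter ?_ (uIcc_subset_uIcc left_mem_uIcc hmem)
      rw [← segment_eq_uIcc]
      exact (convex_ball c r).segment_subset (Metric.mem_ball_self hr) hball
  refine not_ae_inv_le (C := C / (‖H c‖ / 2)) he
    (hz.mono_set (hs.trans inter_subset_right)).norm ?_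
  have hne : ∀ y : ℝ, ∀ᵐ x : ℝ, x ≠ y := fun y => by simp [ae_iff, measure_singleton]
  filter_upwards [h, hne c, hne d] with x hx hxc hxd hm
  have hm' := hs (uIoc_subset_uIcc hm)
  have h1 : ‖H c‖ / 2 < ‖H x‖ := hb hm'
  have h2 := hx (by
    obtain ⟨h3, h4⟩ := hm'.2
    refine ⟨lt_of_le_of_ne h3 ?_, lt_of_le_of_ne h4 ?_⟩
    · rcases min_choice c d with h | h <;> rw [h] <;> exact Ne.symm ‹_›
    · rcases max_choice c d with h | h <;> rw [h] <;> assumption)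
  have h3 : 0 < |x - c| := abs_pos.2 (sub_ne_zero.2 hxc)
  rw [div_mul_eq_mul_div, inv_le_iff_one_le_mul₀ h3, div_mul_eq_mul_div, one_le_div hpos]
  linarith

/-! ### The homogeneous solution and the variation-of-constants kernel -/

/-- The positive solution of `(1 - a cos x) y + b sin x · y' = 0` on `(-π, 0) ∪ (0, π)`. -/
noncomputable def homSol (a b x : ℝ) : ℝ :=
  (1 + Real.cos x) ^ (1 / b) * (Real.sin x ^ 2) ^ ((a - 1) / (2 * b))

/-- The kernel of variation of constants. -/
noncomputable def varKer (a b x : ℝ) : ℝ := (b * Real.sin x * homSol a b x)⁻¹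

theorem one_add_cos_pos {x : ℝ} (hx : x ∈ Ioo (-Real.pi) Real.pi) : 0 < 1 + Real.cos x := by
  have h := Real.cos_pos_of_mem_Ioo (x := x / 2) ⟨by linarith [hx.1], by linarith [hx.2]⟩
  have := Real.cos_sq (x / 2)
  rw [show 2 * (x / 2) = x by ring] at this
  nlinarith

theorem sin_ne_zero_of_mem_punctured {x : ℝ} (hx : x ∈ punctured) : Real.sin x ≠ 0 := by
  rcases hx with h | h
  · exact (Real.sin_neg_of_neg_of_neg_pi_lt h.2 h.1).ne
  · exact (Real.sin_pos_of_pos_of_lt_pi h.1 h.2).ne'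

theorem homSol_pos (a b : ℝ) {x : ℝ} (hx : x ∈ punctured) : 0 < homSol a b x := by
  have h1 := one_add_cos_pos (punctured_subset hx)
  have h2 := sin_ne_zero_of_mem_punctured hx
  unfold homSol
  positivity

theorem homSol_neg (a b x : ℝ) : homSol a b (-x) = homSol a b x := by simp [homSol]

theorem varKer_neg (a b x : ℝ) : varKer a b (-x) = -varKer a b x := by
  simp [varKer, homSol_neg]

theorem hasDerivAt_homSol (a : ℝ) {b x : ℝ} (hb : 0 < b) (hx : x ∈ punctured) :
    HasDerivAt (homSol a b)
      (-((1 - a * Real.cos x) / (b * Real.sin x)) * homSol a b x) x := by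
  have h1 := one_add_cos_pos (punctured_subset hx)
  have h2 := sin_ne_zero_of_mem_punctured hx
  have h3 : 0 < Real.sin x ^ 2 := by positivity
  have d1 := ((Real.hasDerivAt_cos x).const_add 1).rpow_const (p := 1 / b) (Or.inl h1.ne')
  have d2 := ((Real.hasDerivAt_sin x).fun_pow 2).rpow_const (p := (a - 1) / (2 * b))
    (Or.inl h3.ne')
  refine (d1.mul d2).congr_deriv ?_
  rw [Real.rpow_sub_one h1.ne', Real.rpow_sub_one h3.ne', homSol]
  have hs : Real.sin x ^ 2 = (1 + Real.cos x) * (1 - Real.cos x) := by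
    rw [Real.sin_sq]; ring
  generalize (1 + Real.cos x) ^ (1 / b) = A
  generalize (Real.sin x ^ 2) ^ ((a - 1) / (2 * b)) = B
  field_simp
  push_cast
  simp only [pow_one]
  linear_combination (-2 * A * B * Real.sin x) * hs

theorem contDiffOn_homSol (a b : ℝ) : ContDiffOn ℝ 1 (homSol a b) punctured := by
  intro x hx
  have h1 := one_add_cos_pos (punctured_subset hx)
  have h2 := sin_ne_zero_of_mem_punctured hx
  have h3 : 0 < Real.sin x ^ 2 := by positivity
  refine ContDiffAt.contDiffWithinAt ?_
  unfold homSol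
  exact ((contDiffAt_const.add Real.contDiff_cos.contDiffAt).rpow_const_of_ne h1.ne').mul
    ((Real.contDiff_sin.contDiffAt.pow 2).rpow_const_of_ne h3.ne')

theorem continuousOn_varKer (a : ℝ) {b : ℝ} (hb : 0 < b) :
    ContinuousOn (varKer a b) punctured := by
  refine ContinuousOn.inv₀ ?_ fun x hx => ?_
  · exact (continuousOn_const.mul Real.continuous_sin.continuousOn).mul
      (contDiffOn_homSol a b).continuousOn
  · exact mul_ne_zero (mul_ne_zero hb.ne' (sin_ne_zero_of_mem_punctured hx)) (homSol_pos a b hx).ne'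

theorem mem_punctured_of_pos {x : ℝ} (h0 : 0 < x) (h1 : x < Real.pi) : x ∈ punctured :=
  Or.inr ⟨h0, h1⟩

/-- Source of the coercivity constant: used with `a + b / 2` in the energy estimates and with `a` to
divide by `1 - a cos x`. -/
theorem le_one_sub_mul_cos (k x : ℝ) : 1 - |k| ≤ 1 - k * Real.cos x := by
  have h1 : k * Real.cos x ≤ |k| * |Real.cos x| := by rw [← abs_mul]; exact le_abs_self _
  have h2 := mul_le_mul_of_nonneg_left (Real.abs_cos_le_one x) (abs_nonneg k)
  linarith

/-! ### Behaviour of solution and kernel near the origin -/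

/-- The continuous extension to `0` of `1 / (sin x · homSol²)`. -/
noncomputable def energyWeight (a b x : ℝ) : ℝ :=
  (1 + Real.cos x) ^ (-(2 / b)) * Real.sin x ^ ((2 - 2 * a - b) / b)

theorem energyWeight_eq (a : ℝ) {b x : ℝ} (hb : 0 < b) (h0 : 0 < x) (h1 : x < Real.pi) :
    energyWeight a b x = (Real.sin x * homSol a b x ^ 2)⁻¹ := by
  have hx := mem_punctured_of_pos h0 h1
  have h1 := one_add_cos_pos (punctured_subset hx)
  have h2 : 0 < Real.sin x := Real.sin_pos_of_pos_of_lt_pi h0 ‹_›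
  unfold energyWeight homSol
  rw [mul_pow, ← Real.rpow_natCast, ← Real.rpow_natCast, ← Real.rpow_natCast,
    ← Real.rpow_mul h1.le, ← Real.rpow_mul h2.le, ← Real.rpow_mul h2.le, mul_inv, mul_inv,
    ← Real.rpow_neg h1.le, ← Real.rpow_neg_one (Real.sin x), ← Real.rpow_neg h2.le]
  rw [mul_left_comm, ← Real.rpow_add h2]
  congr 2
  · push_cast; ring
  · push_cast; field_simp; ring

/-- The ODE for `homSol` gives `(sin · homSol²)' = -(2 / b) (1 - (a + b / 2) cos) homSol²`. The
derivative of the reciprocal is thus comparable to `varKer²`. -/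
theorem energyWeight_pos_hasDerivAt (a : ℝ) {b x : ℝ} (hb : 0 < b) (h0 : 0 < x)
    (h1 : x < Real.pi) : HasDerivAt (energyWeight a b)
      (2 * b * (1 - (a + b / 2) * Real.cos x) * varKer a b x ^ 2) x := by
  have hx := mem_punctured_of_pos h0 h1
  have hw := homSol_pos a b hx
  have h2 : 0 < Real.sin x := Real.sin_pos_of_pos_of_lt_pi h0 h1
  have hd := ((Real.hasDerivAt_sin x).mul ((hasDerivAt_homSol a hb hx).fun_pow 2)).inv
    (by simp only [Pi.mul_apply]; positivity)
  have hev : energyWeight a b =ᶠ[nhds x] (Real.sin * fun y => homSol a b y ^ 2)⁻¹ := by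
    filter_upwards [isOpen_Ioo.mem_nhds (show x ∈ Ioo 0 Real.pi from ⟨h0, h1⟩)] with y hy
    rw [energyWeight_eq a hb hy.1 hy.2]; rfl
  refine (hd.congr_of_eventuallyEq hev).congr_deriv ?_
  simp only [varKer, Pi.mul_apply]
  field_simp
  push_cast
  ring

theorem continuousOn_energyWeight {a b d : ℝ} (hb : 0 < b) (hab : |a + b / 2| < 1)
    (hd : d < Real.pi) : ContinuousOn (energyWeight a b) (Icc 0 d) := by
  have := (abs_lt.1 hab).2
  refine ContinuousOn.mul ?_ ?_
  · refine ContinuousOn.rpow_const (by fun_prop) fun x hx => Or.inl ?_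
    exact (one_add_cos_pos ⟨by linarith [hx.1, Real.pi_pos], hx.2.trans_lt hd⟩).ne'
  · refine ContinuousOn.rpow_const (by fun_prop) fun x hx => Or.inr ?_
    apply div_nonneg _ hb.le
    linarith

/-- The exponent `(2 - 2 * a - b) / b` of the sine is positive exactly because `a + b / 2 < 1`; this
is where `2 * a + b < 2` acts. -/
theorem energyWeight_zero {a b : ℝ} (hb : 0 < b) (hab : |a + b / 2| < 1) :
    energyWeight a b 0 = 0 := by
  have := (abs_lt.1 hab).2
  rw [energyWeight, Real.sin_zero, Real.zero_rpow, mul_zero]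
  exact (div_pos (by linarith) hb).ne'

/-- The integrand is at most a constant times the derivative of `energyWeight`, which vanishes at
`0`. Integrability is automatic: a continuous function with nonnegative derivative has an integrable
derivative. -/
theorem varKer_sq_integral_le {a b x : ℝ} (hb : 0 < b) (hab : |a + b / 2| < 1) (h0 : 0 < x)
    (h1 : x < Real.pi) : IntegrableOn (fun t => varKer a b t ^ 2) (Ioc 0 x) ∧
      2 * b * (1 - |a + b / 2|) * ∫ t in (0 : ℝ)..x, varKer a b t ^ 2 ≤
        (Real.sin x * homSol a b x ^ 2)⁻¹ := by
  set c := 1 - |a + b / 2| with hc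
  have hc0 : 0 < c := by linarith
  have hle : ∀ t, 2 * b * c * varKer a b t ^ 2 ≤
      2 * b * (1 - (a + b / 2) * Real.cos t) * varKer a b t ^ 2 := fun t => by
    have := le_one_sub_mul_cos (a + b / 2) t
    gcongr
  have hder : ∀ t ∈ Ioo 0 x, HasDerivAt (energyWeight a b)
      (2 * b * (1 - (a + b / 2) * Real.cos t) * varKer a b t ^ 2) t := fun t ht =>
    energyWeight_pos_hasDerivAt a hb ht.1 (ht.2.trans h1)
  have hcont := continuousOn_energyWeight hb hab h1
  have hI := intervalIntegral.integrableOn_deriv_of_nonneg hcont hder fun t _ =>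
    le_trans (by positivity) (hle t)
  have hmeas : AEStronglyMeasurable (fun t => varKer a b t ^ 2) (volume.restrict (Ioc 0 x)) :=
    ((continuousOn_varKer a hb).mono fun t ht =>
      mem_punctured_of_pos ht.1 (ht.2.trans_lt h1)).pow 2 |>.aestronglyMeasurable measurableSet_Ioc
  have hq : IntegrableOn (fun t => 2 * b * c * varKer a b t ^ 2) (Ioc 0 x) := by
    refine hI.mono' (hmeas.const_mul _) (Filter.Eventually.of_forall fun t => ?_)
    rw [Real.norm_of_nonneg (by positivity)]
    exact hle t
  have hq' : IntegrableOn (fun t => varKer a b t ^ 2) (Ioc 0 x) := by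
    have := hq.const_mul (2 * b * c)⁻¹
    refine this.congr (Filter.Eventually.of_forall fun t => ?_)
    dsimp only
    field_simp
  refine ⟨hq', ?_⟩
  have hII := (intervalIntegrable_iff_integrableOn_Ioc_of_le h0.le).2 hI
  have := intervalIntegral.integral_eq_sub_of_hasDerivAt_of_le h0.le hcont hder hII
  rw [energyWeight_zero hb hab, energyWeight_eq a hb h0 h1, sub_zero] at this
  rw [← this, ← intervalIntegral.integral_const_mul]
  exact intervalIntegral.integral_mono_on h0.le
    ((intervalIntegrable_iff_integrableOn_Ioc_of_le h0.le).2 hq) hII fun t _ => hle t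

/-- `homSol²` dominates `1 / |x|` near the origin. -/
theorem inv_abs_le_homSol_sq {a b x : ℝ} (hb : 0 < b) (hab : |a + b / 2| < 1) (h0 : x ≠ 0)
    (h1 : |x| < Real.pi / 2) : |x|⁻¹ ≤ homSol a b x ^ 2 := by
  wlog hx : 0 < x generalizing x
  · have := this (x := -x) (neg_ne_zero.2 h0) (by rwa [abs_neg])
      (by rcases lt_or_gt_of_ne h0 with h | h <;> [linarith; exact absurd h hx])
    rwa [abs_neg, homSol_neg] at this
  rw [abs_of_pos hx] at h1 ⊢
  have hpi : x < Real.pi := by linarith [Real.pi_pos]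
  have hs : 0 < Real.sin x := Real.sin_pos_of_pos_of_lt_pi hx hpi
  have hw := homSol_pos a b (mem_punctured_of_pos hx hpi)
  have hcos : 0 ≤ Real.cos x := Real.cos_nonneg_of_mem_Icc ⟨by linarith, h1.le⟩
  have habs := (abs_lt.1 hab).2
  -- As `cos x ≥ 0`, the base `1 + cos x` is at least `1` and carries a negative exponent; the sine
  -- is at most `1` and carries a nonnegative one.
  have hV : energyWeight a b x ≤ 1 := by
    refine mul_le_one₀ ?_ (by positivity) ?_
    · exact Real.rpow_le_one_of_one_le_of_nonpos (by linarith)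
        (neg_nonpos.2 (by positivity))
    · exact Real.rpow_le_one hs.le (Real.sin_le_one x) (div_nonneg (by linarith) hb.le)
  rw [energyWeight_eq a hb hx hpi, inv_le_one₀ (by positivity)] at hV
  rw [inv_le_iff_one_le_mul₀ hx]
  calc 1 ≤ Real.sin x * homSol a b x ^ 2 := hV
    _ ≤ x * homSol a b x ^ 2 := by gcongr; exact Real.sin_le hx.le
    _ = _ := mul_comm _ _

/-! ### The energy estimate on the half interval -/

theorem integral_mul_sq_le {α : Type*} [MeasurableSpace α] {ν : Measure α} {f h : α → ℝ}
    (hf0 : ∀ x, 0 ≤ f x) (hh0 : 0 ≤ᵐ[ν] h) (hf : MemLp f 2 ν) (hh : MemLp h 2 ν) :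
    (∫ x, f x * h x ∂ν) ^ 2 ≤ (∫ x, f x ^ 2 ∂ν) * ∫ x, h x ^ 2 ∂ν := by
  have h2 : ENNReal.ofReal 2 = 2 := by simp
  have key := integral_mul_le_Lp_mul_Lq_of_nonneg Real.HolderConjugate.two_two
    (Filter.Eventually.of_forall hf0) hh0 (h2 ▸ hf) (h2 ▸ hh)
  have hA : 0 ≤ ∫ x, f x ^ 2 ∂ν := integral_nonneg fun x => sq_nonneg _
  have hB : 0 ≤ ∫ x, h x ^ 2 ∂ν := integral_nonneg fun x => sq_nonneg _
  have h0 : 0 ≤ ∫ x, f x * h x ∂ν := integral_nonneg_of_ae (by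
    filter_upwards [hh0] with x hx using mul_nonneg (hf0 x) hx)
  simp only [Real.rpow_two, ← Real.sqrt_eq_rpow] at key
  calc _ ≤ (√(∫ x, f x ^ 2 ∂ν) * √(∫ x, h x ^ 2 ∂ν)) ^ 2 := by gcongr
    _ = _ := by rw [mul_pow, Real.sq_sqrt hA, Real.sq_sqrt hB]

theorem varKer_memLp {a b x : ℝ} (hb : 0 < b) (hab : |a + b / 2| < 1) (h0 : 0 < x)
    (h1 : x < Real.pi) : MemLp (varKer a b) 2 (volume.restrict (Ioc 0 x)) := by
  refine (memLp_two_iff_integrable_sq ?_).2 (varKer_sq_integral_le hb hab h0 h1).1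
  exact ((continuousOn_varKer a hb).mono fun t ht =>
      mem_punctured_of_pos ht.1 (ht.2.trans_lt h1)).aestronglyMeasurable measurableSet_Ioc

theorem varKer_pos (a : ℝ) {b x : ℝ} (hb : 0 < b) (h0 : 0 < x) (h1 : x < Real.pi) :
    0 < varKer a b x := by
  have hw := homSol_pos a b (mem_punctured_of_pos h0 h1)
  have h2 : 0 < Real.sin x := Real.sin_pos_of_pos_of_lt_pi h0 h1
  unfold varKer
  positivity

theorem intervalIntegrable_mul_varKer {g : ℝ → ℝ} {a b x : ℝ} (hb : 0 < b)
    (hab : |a + b / 2| < 1) (h0 : 0 ≤ x) (h1 : x < Real.pi)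
    (hg : MemLp g 2 (volume.restrict (Ioo 0 Real.pi))) :
    IntervalIntegrable (fun t => g t * varKer a b t) volume 0 x := by
  rcases h0.eq_or_lt with rfl | h0
  · exact IntervalIntegrable.refl
  rw [intervalIntegrable_iff_integrableOn_Ioc_of_le h0.le]
  have hg' := hg.mono_measure (Measure.restrict_mono (fun t ht =>
    (⟨ht.1, ht.2.trans_lt h1⟩ : t ∈ Ioo 0 Real.pi)) le_rfl : volume.restrict (Ioc 0 x) ≤ _)
  exact hg'.integrable_mul (varKer_memLp hb hab h0 h1)

/-- By Cauchy–Schwarz, the squared integral is at most `∫ g²` times `∫ varKer²`, and the prefactor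
cancels the bound on the latter. The estimate is uniform in `x`, so it controls the energy boundary
term as `x` tends to `0`. -/
theorem sin_mul_sq_le {g : ℝ → ℝ} {a b x : ℝ} (hb : 0 < b)
    (hab : |a + b / 2| < 1) (h0 : 0 < x) (h1 : x < Real.pi) (hg0 : ∀ t, 0 ≤ g t)
    (hg : MemLp g 2 (volume.restrict (Ioo 0 Real.pi))) :
    b * (Real.sin x * homSol a b x ^ 2) * (∫ t in (0 : ℝ)..x, g t * varKer a b t) ^ 2 ≤
      (2 * (1 - |a + b / 2|))⁻¹ * ∫ t in Ioo 0 Real.pi, g t ^ 2 := by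
  have hsub : Ioc 0 x ⊆ Ioo 0 Real.pi := fun t ht => ⟨ht.1, ht.2.trans_lt h1⟩
  have hg' := hg.mono_measure (Measure.restrict_mono hsub le_rfl)
  have hc0 : 0 < 1 - |a + b / 2| := by linarith
  have hw := homSol_pos a b (mem_punctured_of_pos h0 h1)
  have hs : 0 < Real.sin x := Real.sin_pos_of_pos_of_lt_pi h0 h1
  have hq0 : 0 ≤ᵐ[volume.restrict (Ioc 0 x)] varKer a b := by
    filter_upwards [ae_restrict_mem measurableSet_Ioc] with t ht
      using (varKer_pos a hb ht.1 (ht.2.trans_lt h1)).le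
  have hcs := integral_mul_sq_le hg0 hq0 hg' (varKer_memLp hb hab h0 h1)
  have hq := (varKer_sq_integral_le hb hab h0 h1).2
  rw [intervalIntegral.integral_of_le h0.le] at hq ⊢
  have hmono : ∫ t in Ioc 0 x, g t ^ 2 ≤ ∫ t in Ioo 0 Real.pi, g t ^ 2 :=
    setIntegral_mono_set hg.integrable_sq (Filter.Eventually.of_forall fun t => sq_nonneg _)
      hsub.eventuallyLE
  set A := ∫ t in Ioc 0 x, g t ^ 2
  set G := ∫ t in Ioo 0 Real.pi, g t ^ 2
  set Q := ∫ t in Ioc 0 x, varKer a b t ^ 2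
  set W := Real.sin x * homSol a b x ^ 2
  have hW : 0 < W := by positivity
  have hQ : 0 ≤ Q := integral_nonneg fun t => sq_nonneg _
  have hG : 0 ≤ G := integral_nonneg fun t => sq_nonneg _
  calc b * W * (∫ t in Ioc 0 x, g t * varKer a b t) ^ 2 ≤ b * W * (A * Q) := by gcongr
    _ ≤ b * W * (G * Q) := by gcongr
    _ = (2 * (1 - |a + b / 2|))⁻¹ * W * G * (2 * b * (1 - |a + b / 2|) * Q) := by
        generalize 1 - |a + b / 2| = k at hc0 ⊢
        field_simp
    _ ≤ (2 * (1 - |a + b / 2|))⁻¹ * W * G * W⁻¹ := by gcongr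
    _ = _ := by field_simp

/-- With `Y = homSol · I` the solution for the right-hand side `g`, the energy `T = b sin · Y²`
satisfies `T' = 2 g Y - 2 (1 - (a + b / 2) cos) Y²`. Integrating over `[e, d]` bounds `∫ Y²` by `∫
g²` and `T e`, since `T d ≥ 0`. The bound does not depend on `e` and `d`. -/
theorem energy_bound {g : ℝ → ℝ} {a b e d : ℝ} (hb : 0 < b)
    (hab : |a + b / 2| < 1) (he : 0 < e) (hed : e ≤ d) (hd : d < Real.pi) (hg0 : ∀ t, 0 ≤ g t)
    (hg : MemLp g 2 (volume.restrict (Ioo 0 Real.pi))) :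
    ∫ x in e..d, (homSol a b x * ∫ t in (0 : ℝ)..x, g t * varKer a b t) ^ 2 ≤
      3 / (2 * (1 - |a + b / 2|) ^ 2) * ∫ t in Ioo 0 Real.pi, g t ^ 2 := by
  set c := 1 - |a + b / 2| with hc
  have hc0 : 0 < c := by linarith
  set I : ℝ → ℝ := fun x => ∫ t in (0 : ℝ)..x, g t * varKer a b t with hI
  set G := ∫ t in Ioo 0 Real.pi, g t ^ 2
  have hG : 0 ≤ G := integral_nonneg fun t => sq_nonneg _
  have hint := intervalIntegrable_mul_varKer hb hab (he.le.trans hed) hd hg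
  have hsub : uIcc e d ⊆ uIcc 0 d := by
    rw [uIcc_of_le hed, uIcc_of_le (he.le.trans hed)]
    exact Icc_subset_Icc_left he.le
  have hpun : uIcc e d ⊆ punctured := by
    rw [uIcc_of_le hed]
    exact fun t ht => mem_punctured_of_pos (he.trans_le ht.1) (ht.2.trans_lt hd)
  have hIac : AbsolutelyContinuousOnInterval I e d :=
    (hint.absolutelyContinuousOnInterval_intervalIntegral left_mem_uIcc).mono hsub
  set N : ℝ → ℝ := fun x => b * (Real.sin x * homSol a b x ^ 2) with hN
  have hNac : AbsolutelyContinuousOnInterval N e d := by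
    refine ContDiffOn.absolutelyContinuousOnInterval ?_
    exact contDiffOn_const.mul
      (Real.contDiff_sin.contDiffOn.mul (((contDiffOn_homSol a b).mono hpun).pow 2))
  set T : ℝ → ℝ := fun x => N x * (I x * I x) with hT
  have hTac : AbsolutelyContinuousOnInterval T e d := hNac.mul (hIac.mul hIac)
  have hwc : ContinuousOn (homSol a b) (uIcc e d) := (contDiffOn_homSol a b).continuousOn.mono hpun
  have hderiv : ∀ᵐ x, x ∈ uIcc e d →
      deriv T x ≤ c⁻¹ * g x ^ 2 - c * (homSol a b x * I x) ^ 2 := by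
    filter_upwards [hint.ae_hasDerivAt_integral] with x hx hm
    have dI : HasDerivAt I (g x * varKer a b x) x := hx (hsub hm) 0 left_mem_uIcc
    have dN : HasDerivAt N (-2 * ((1 - (a + b / 2) * Real.cos x) * homSol a b x ^ 2)) x := by
      have hs := sin_ne_zero_of_mem_punctured (hpun hm)
      refine (((Real.hasDerivAt_sin x).mul
        ((hasDerivAt_homSol a hb (hpun hm)).fun_pow 2)).const_mul b).congr_deriv ?_
      field_simp
      push_cast
      ring
    have dT := dN.mul (dI.mul dI)
    rw [show deriv T x = _ from dT.deriv]
    have hq : N x * varKer a b x = homSol a b x := by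
      have hs := sin_ne_zero_of_mem_punctured (hpun hm)
      have hw := homSol_pos a b (hpun hm)
      simp only [hN, varKer]
      field_simp
    have h1 := le_one_sub_mul_cos (a + b / 2) x
    have h2 : c * (homSol a b x * I x) ^ 2 ≤
        (1 - (a + b / 2) * Real.cos x) * (homSol a b x * I x) ^ 2 := by gcongr
    -- Young's inequality as a square: `2 g Y ≤ c⁻¹ g² + c Y²` absorbs half of the coercive term `2
    -- c Y²`.
    have h3 : 0 ≤ c⁻¹ * (g x - c * (homSol a b x * I x)) ^ 2 := by positivity
    have h4 : c⁻¹ * (g x - c * (homSol a b x * I x)) ^ 2 =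
        c⁻¹ * g x ^ 2 - 2 * g x * (homSol a b x * I x) + c * (homSol a b x * I x) ^ 2 := by
      field_simp
      ring
    simp only [Pi.mul_apply]
    have h5 : N x * (g x * varKer a b x * I x + I x * (g x * varKer a b x)) =
        2 * g x * (homSol a b x * I x) := by
      rw [← hq]; ring
    linarith
  have hg2 : IntervalIntegrable (fun x => g x ^ 2) volume e d := by
    rw [intervalIntegrable_iff_integrableOn_Ioc_of_le hed]
    exact IntegrableOn.mono_set hg.integrable_sq fun t ht =>
      ⟨he.trans ht.1, ht.2.trans_lt hd⟩
  have hY2 : IntervalIntegrable (fun x => (homSol a b x * I x) ^ 2) volume e d :=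
    ((hwc.mul hIac.continuousOn).pow 2).intervalIntegrable
  have hmono : ∫ x in e..d, deriv T x ≤
      ∫ x in e..d, (c⁻¹ * g x ^ 2 - c * (homSol a b x * I x) ^ 2) := by
    refine intervalIntegral.integral_mono_ae_restrict hed hTac.intervalIntegrable_deriv
      ((hg2.const_mul _).sub (hY2.const_mul _)) ?_
    rw [Filter.EventuallyLE, ae_restrict_iff' measurableSet_Icc]
    rwa [uIcc_of_le hed] at hderiv
  rw [hTac.integral_deriv_eq_sub, intervalIntegral.integral_sub (hg2.const_mul _)
    (hY2.const_mul _), intervalIntegral.integral_const_mul,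
    intervalIntegral.integral_const_mul] at hmono
  have hgle : ∫ x in e..d, g x ^ 2 ≤ G := by
    rw [intervalIntegral.integral_of_le hed]
    exact setIntegral_mono_set hg.integrable_sq (Filter.Eventually.of_forall fun t => sq_nonneg _)
      (LE.le.eventuallyLE fun t ht => ⟨he.trans ht.1, ht.2.trans_lt hd⟩)
  have hTe : T e ≤ (2 * c)⁻¹ * G := by
    have := sin_mul_sq_le hb hab he (hed.trans_lt hd) hg0 hg
    simpa only [hT, hN, ← sq] using this
  have hTd : 0 ≤ T d := by
    have hs : 0 < Real.sin d := Real.sin_pos_of_pos_of_lt_pi (he.trans_le hed) hd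
    have : 0 ≤ I d * I d := mul_self_nonneg _
    simp only [hT, hN]
    positivity
  have h6 : c⁻¹ * ∫ x in e..d, g x ^ 2 ≤ c⁻¹ * G := by gcongr
  -- The factor `3 / 2` is `1` from the integral of `g²` plus `1 / 2` from the boundary term at `e`.
  have h7 : c * ∫ x in e..d, (homSol a b x * I x) ^ 2 ≤ (3 / (2 * c)) * G := by
    have : (3 / (2 * c)) * G = c⁻¹ * G + (2 * c)⁻¹ * G := by field_simp; ring
    linarith
  have h8 : 3 / (2 * c ^ 2) * G = c⁻¹ * ((3 / (2 * c)) * G) := by field_simp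
  rw [h8, le_inv_mul_iff₀ hc0]
  exact h7

/-! ### The particular solution on the whole interval -/

/-- Variation of constants: the solution of `(1 - a cos x) y + b sin x · y' = g` that is regular at
the origin. -/
noncomputable def varSol (a b : ℝ) (g : ℝ → ℂ) (x : ℝ) : ℂ :=
  (homSol a b x : ℂ) * ∫ t in (0 : ℝ)..x, g t * (varKer a b t : ℂ)

theorem measurePreserving_neg_mu : MeasurePreserving (fun x : ℝ => -x) mu mu := by
  have h := (Measure.measurePreserving_neg (volume : Measure ℝ)).restrict_preimage
    (s := Ioo (-Real.pi) Real.pi) measurableSet_Ioo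
  have hs : Neg.neg ⁻¹' Ioo (-Real.pi) Real.pi = Ioo (-Real.pi) Real.pi := by simp
  rwa [hs] at h

theorem memLp_restrict_of_mu {E : Type*} [NormedAddCommGroup E] {g : ℝ → E} {p : ℝ≥0∞}
    (hg : MemLp g p mu) {s : Set ℝ} (hs : s ⊆ Ioo (-Real.pi) Real.pi) :
    MemLp g p (volume.restrict s) :=
  hg.mono_measure (Measure.restrict_mono hs le_rfl)

theorem Ioo_zero_pi_subset : Ioo 0 Real.pi ⊆ Ioo (-Real.pi) Real.pi :=
  Ioo_subset_Ioo_left (by linarith [Real.pi_pos])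

theorem intervalIntegrable_mul_varKer_complex {g : ℝ → ℂ} {a b x : ℝ} (hb : 0 < b)
    (hab : |a + b / 2| < 1) (hx : x ∈ Ioo (-Real.pi) Real.pi) (hg : MemLp g 2 mu) :
    IntervalIntegrable (fun t => g t * (varKer a b t : ℂ)) volume 0 x := by
  -- The kernel is odd, so reflecting `g` exchanges the two halves.
  wlog h0 : 0 ≤ x generalizing x g
  · have := this (x := -x) (g := fun t => g (-t)) ⟨by linarith [hx.2], by linarith [hx.1]⟩
      (hg.comp_measurePreserving measurePreserving_neg_mu) (by linarith)
    rw [IntervalIntegrable.iff_comp_neg]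
    refine (neg_zero (G := ℝ) ▸ this).neg.congr fun t _ => ?_
    simp [varKer_neg]
  rcases h0.eq_or_lt with rfl | h0
  · exact IntervalIntegrable.refl
  rw [intervalIntegrable_iff_integrableOn_Ioc_of_le h0.le]
  have hg' := memLp_restrict_of_mu hg (s := Ioc 0 x) fun t ht =>
    ⟨by linarith [ht.1, Real.pi_pos], ht.2.trans_lt hx.2⟩
  exact hg'.integrable_mul (varKer_memLp hb hab h0 hx.2).ofReal

/-- Integrability is known only up to interior points, so the interval is exhausted by countably
many segments with rational end points on either side of `0`. -/
theorem ae_hasDerivAt_primitive {f : ℝ → ℂ} {p q : ℝ} (h0 : (0 : ℝ) ∈ Ioo p q)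
    (h : ∀ x ∈ Ioo p q, IntervalIntegrable f volume 0 x) :
    ∀ᵐ x : ℝ, x ∈ Ioo p q → HasDerivAt (fun x => ∫ t in (0 : ℝ)..x, f t) (f x) x := by
  have h1 : ∀ c d : ℚ, ∀ᵐ x : ℝ, (c : ℝ) ∈ Ioo p 0 → (d : ℝ) ∈ Ioo 0 q →
      x ∈ Icc (c : ℝ) d → HasDerivAt (fun x => ∫ t in (0 : ℝ)..x, f t) (f x) x := by
    intro c d
    by_cases hcd : (c : ℝ) ∈ Ioo p 0 ∧ (d : ℝ) ∈ Ioo 0 q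
    · have hi : IntervalIntegrable f volume c d :=
        (h c ⟨hcd.1.1, hcd.1.2.trans h0.2⟩).symm.trans (h d ⟨h0.1.trans hcd.2.1, hcd.2.2⟩)
      have hle : (c : ℝ) ≤ d := (hcd.1.2.trans hcd.2.1).le
      filter_upwards [hi.ae_hasDerivAt_integral] with x hx _ _ hm
      rw [← uIcc_of_le hle] at hm
      refine hx hm 0 ?_
      rw [uIcc_of_le hle]
      exact ⟨hcd.1.2.le, hcd.2.1.le⟩
    · exact Filter.Eventually.of_forall fun x h1 h2 => absurd ⟨h1, h2⟩ hcd
  have h2 := ae_all_iff.2 fun c => ae_all_iff.2 fun d => h1 c d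
  filter_upwards [h2] with x hx hm
  obtain ⟨c, hc1, hc2⟩ := exists_rat_btwn (lt_min hm.1 h0.1)
  obtain ⟨d, hd1, hd2⟩ := exists_rat_btwn (max_lt hm.2 h0.2)
  exact hx c d ⟨hc1, hc2.trans_le (min_le_right _ _)⟩ ⟨(le_max_right _ _).trans_lt hd1, hd2⟩
    ⟨(hc2.trans_le (min_le_left _ _)).le, ((le_max_left _ _).trans_lt hd1).le⟩

theorem locallyACOn_varSol {g : ℝ → ℂ} {a b : ℝ} (hb : 0 < b) (hab : |a + b / 2| < 1)
    (hg : MemLp g 2 mu) : LocallyACOn (varSol a b g) punctured := by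
  intro c d hcd hs
  have hpi := Real.pi_pos
  have hc := punctured_subset (hs (left_mem_Icc.2 hcd))
  have hd := punctured_subset (hs (right_mem_Icc.2 hcd))
  have h0 : (0 : ℝ) ∈ Ioo (-Real.pi) Real.pi := ⟨by linarith, hpi⟩
  have hint := fun x hx => intervalIntegrable_mul_varKer_complex (x := x) hb hab hx hg
  have hle : min c 0 ≤ max d 0 := (min_le_right _ _).trans (le_max_right _ _)
  have hi := (hint (min c 0) ⟨lt_min hc.1 h0.1, (min_le_right _ _).trans_lt h0.2⟩).symm.trans
    (hint (max d 0) ⟨h0.1.trans_le (le_max_right _ _), max_lt hd.2 h0.2⟩)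
  have hI := ac_intervalIntegral hi (c := 0) (by
    rw [uIcc_of_le hle]; exact ⟨min_le_right _ _, le_max_right _ _⟩)
  have hI' := hI.mono (c := c) (d := d) (by
    rw [uIcc_of_le hle, uIcc_of_le hcd]
    exact Icc_subset_Icc (min_le_left _ _) (le_max_left _ _))
  refine ac_mul (ac_ofReal ?_) hI'
  refine ContDiffOn.absolutelyContinuousOnInterval ((contDiffOn_homSol a b).mono ?_)
  rwa [uIcc_of_le hcd]

theorem flux_varSol {g : ℝ → ℂ} {a b : ℝ} (hb : 0 < b) (hab : |a + b / 2| < 1)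
    (hg : MemLp g 2 mu) : g =ᵐ[mu] flux a b (varSol a b g) := by
  have h0 : (0 : ℝ) ∈ Ioo (-Real.pi) Real.pi := ⟨by linarith [Real.pi_pos], Real.pi_pos⟩
  filter_upwards [ae_mem_punctured, ae_restrict_of_ae (ae_hasDerivAt_primitive h0
    fun x hx => intervalIntegrable_mul_varKer_complex hb hab hx hg)] with x hx hI
  have hd := (hasDerivAt_homSol a hb hx).ofReal_comp.mul (hI (punctured_subset hx))
  have hs : (Real.sin x : ℂ) ≠ 0 := by exact_mod_cast sin_ne_zero_of_mem_punctured hx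
  have hw : (homSol a b x : ℂ) ≠ 0 := by exact_mod_cast (homSol_pos a b hx).ne'
  have hb' : (b : ℂ) ≠ 0 := by exact_mod_cast hb.ne'
  rw [flux, show deriv (varSol a b g) x = _ from hd.deriv, varSol]
  generalize (∫ t in (0 : ℝ)..x, g t * (varKer a b t : ℂ)) = J
  rw [varKer]
  push_cast at hs ⊢
  field_simp
  ring

/-- `homSol` is even and `varKer` is odd. This carries the estimate from `(0, π)` over to `(-π, 0)`.
-/
theorem varSol_neg (a b : ℝ) (g : ℝ → ℂ) (x : ℝ) :
    varSol a b g (-x) = varSol a b (fun t => g (-t)) x := by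
  have h : ∫ t in (0 : ℝ)..(-x), g t * (varKer a b t : ℂ) =
      -∫ t in (0 : ℝ)..x, g (-t) * (varKer a b (-t) : ℂ) := by
    rw [intervalIntegral.integral_comp_neg (fun t => g t * (varKer a b t : ℂ)), neg_zero,
      intervalIntegral.integral_symm]
  rw [varSol, varSol, homSol_neg, h, ← intervalIntegral.integral_neg]
  congr 1
  refine intervalIntegral.integral_congr fun t _ => ?_
  simp [varKer_neg]

theorem mu_eq_restrict_punctured : mu = volume.restrict punctured := by
  refine Measure.restrict_congr_set (Filter.EventuallyLE.antisymm ?_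
    (LE.le.eventuallyLE punctured_subset))
  have := ae_mem_punctured
  rwa [ae_restrict_iff' measurableSet_Ioo] at this

/-- Positivity of solution and kernel gives a pointwise bound of `‖varSol a b g‖` by the real
solution for `‖g‖`. The uniform energy bound then passes to the limit along segments exhausting `(0,
π)`. -/
theorem varSol_half_bound {g : ℝ → ℂ} {a b : ℝ} (hb : 0 < b) (hab : |a + b / 2| < 1)
    (hg : MemLp g 2 mu) : IntegrableOn (fun x => ‖varSol a b g x‖ ^ 2) (Ioo 0 Real.pi) ∧
      ∫ x in Ioo 0 Real.pi, ‖varSol a b g x‖ ^ 2 ≤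
        3 / (2 * (1 - |a + b / 2|) ^ 2) * ∫ x in Ioo 0 Real.pi, ‖g x‖ ^ 2 := by
  have hpi := Real.pi_gt_three
  set C := 3 / (2 * (1 - |a + b / 2|) ^ 2) * ∫ x in Ioo 0 Real.pi, ‖g x‖ ^ 2
  have hg' : MemLp (fun x => ‖g x‖) 2 (volume.restrict (Ioo 0 Real.pi)) :=
    (memLp_restrict_of_mu hg Ioo_zero_pi_subset).norm
  set e : ℕ → ℝ := fun n => 1 / ((n : ℝ) + 1)
  have he0 : ∀ n, 0 < e n := fun n => Nat.one_div_pos_of_nat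
  have he1 : ∀ n, e n ≤ 1 := fun n => by
    rw [div_le_one (by positivity)]; linarith [Nat.cast_nonneg (α := ℝ) n]
  have het : Filter.Tendsto e Filter.atTop (nhds 0) := tendsto_one_div_add_atTop_nhds_zero_nat
  have het' : Filter.Tendsto (fun n => Real.pi - e n) Filter.atTop (nhds Real.pi) := by
    simpa using het.const_sub Real.pi
  have hcont := (locallyACOn_varSol hb hab hg).continuousOn isOpen_punctured
  have hsub : ∀ n, Icc (e n) (Real.pi - e n) ⊆ Ioo 0 Real.pi := fun n t ht =>
    ⟨(he0 n).trans_le ht.1, by linarith [ht.2, he0 n]⟩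
  have hI : ∀ n, IntegrableOn (fun x => ‖varSol a b g x‖ ^ 2) (Ioc (e n) (Real.pi - e n)) :=
    fun n => ((hcont.mono ((hsub n).trans subset_union_right)).norm.pow 2
      |>.integrableOn_Icc).mono_set Ioc_subset_Icc_self
  have hbd : ∀ n, ∫ x in Ioc (e n) (Real.pi - e n), ‖varSol a b g x‖ ^ 2 ≤ C := by
    intro n
    -- Holds from the first index on, since `e n ≤ 1` and `π > 3`.
    have hle : e n ≤ Real.pi - e n := by linarith [he1 n]
    have hlt : Real.pi - e n < Real.pi := by linarith [he0 n]
    rw [← intervalIntegral.integral_of_le hle]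
    refine le_trans ?_ (energy_bound hb hab (he0 n) hle hlt (fun t => norm_nonneg (g t)) hg')
    refine intervalIntegral.integral_mono_on hle
      ((intervalIntegrable_iff_integrableOn_Ioc_of_le hle).2 (hI n)) ?_ fun x hx => ?_
    · refine ContinuousOn.intervalIntegrable (ContinuousOn.pow (ContinuousOn.mul ?_ ?_) 2)
      · refine (contDiffOn_homSol a b).continuousOn.mono ?_
        rw [uIcc_of_le hle]; exact (hsub n).trans subset_union_right
      · refine ((intervalIntegrable_mul_varKer hb hab ((he0 n).le.trans hle) hlt hg'
          ).absolutelyContinuousOnInterval_intervalIntegral left_mem_uIcc).continuousOn.mono ?_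
        rw [uIcc_of_le hle, uIcc_of_le ((he0 n).le.trans hle)]
        exact Icc_subset_Icc_left (he0 n).le
    · have hx' := hsub n hx
      gcongr
      rw [varSol, norm_mul, Complex.norm_real, Real.norm_of_nonneg (homSol_pos a b (Or.inr hx')).le]
      gcongr
      · exact (homSol_pos a b (Or.inr hx')).le
      refine (intervalIntegral.norm_integral_le_integral_norm hx'.1.le).trans_eq ?_
      refine intervalIntegral.integral_congr_ae (Filter.Eventually.of_forall fun t ht => ?_)
      rw [uIoc_of_le hx'.1.le] at ht
      rw [norm_mul, Complex.norm_real,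
        Real.norm_of_nonneg (varKer_pos a hb ht.1 (ht.2.trans_lt hx'.2)).le]
  have hint : IntegrableOn (fun x => ‖varSol a b g x‖ ^ 2) (Ioc 0 Real.pi) := by
    refine integrableOn_Ioc_of_intervalIntegral_norm_bounded hI het het'
      (I := C) (Filter.Eventually.of_forall fun n => ?_)
    simpa using hbd n
  have hint' := hint.mono_set Ioo_subset_Ioc_self
  refine ⟨hint', ?_⟩
  refine le_of_tendsto ((aecover_Ioo_of_Ioc het het').integral_tendsto_of_countably_generated
    hint') (Filter.Eventually.of_forall fun n => ?_)
  rw [Measure.restrict_restrict measurableSet_Ioc,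
    inter_eq_self_of_subset_left (Ioc_subset_Icc_self.trans (hsub n))]
  exact hbd n

theorem integrable_mu_of_halves {f : ℝ → ℝ} (h1 : IntegrableOn f (Ioo 0 Real.pi))
    (h2 : IntegrableOn (fun x => f (-x)) (Ioo 0 Real.pi)) :
    Integrable f mu ∧ ∫ x, f x ∂mu =
      (∫ x in Ioo 0 Real.pi, f (-x)) + ∫ x in Ioo 0 Real.pi, f x := by
  have hpi := Real.pi_pos
  have hpre : Neg.neg ⁻¹' Ioo (-Real.pi) 0 = Ioo 0 Real.pi := by simp
  have hmp : MeasurePreserving (fun x : ℝ => -x) (volume.restrict (Ioo 0 Real.pi))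
      (volume.restrict (Ioo (-Real.pi) 0)) := by
    have h := (Measure.measurePreserving_neg (volume : Measure ℝ)).restrict_preimage
      (s := Ioo (-Real.pi) 0) measurableSet_Ioo
    rwa [hpre] at h
  have hemb : MeasurableEmbedding (fun x : ℝ => -x) := (MeasurableEquiv.neg ℝ).measurableEmbedding
  have h3 : IntegrableOn f (Ioo (-Real.pi) 0) := (hmp.integrable_comp_emb hemb).1 h2
  rw [mu_eq_restrict_punctured]
  refine ⟨h3.union h1, ?_⟩
  rw [punctured, setIntegral_union (disjoint_left.2 fun x hx hx' => lt_asymm hx.2 hx'.1)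
    measurableSet_Ioo h3 h1, ← hmp.integral_comp hemb]

theorem varSol_memLp {g : ℝ → ℂ} {a b : ℝ} (hb : 0 < b) (hab : |a + b / 2| < 1)
    (hg : MemLp g 2 mu) : MemLp (varSol a b g) 2 mu ∧ ∫ x, ‖varSol a b g x‖ ^ 2 ∂mu ≤
      3 / (2 * (1 - |a + b / 2|) ^ 2) * ∫ x, ‖g x‖ ^ 2 ∂mu := by
  have hgn := hg.comp_measurePreserving measurePreserving_neg_mu
  obtain ⟨h1, h2⟩ := varSol_half_bound hb hab hg
  obtain ⟨h3, h4⟩ := varSol_half_bound hb hab hgn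
  have hfun : (fun x => ‖varSol a b (g ∘ fun x => -x) x‖ ^ 2) =
      fun x => ‖varSol a b g (-x)‖ ^ 2 := by
    funext x; rw [varSol_neg]; rfl
  rw [hfun] at h3 h4
  obtain ⟨h5, h6⟩ := integrable_mu_of_halves h1 h3
  have hm : AEStronglyMeasurable (varSol a b g) mu := by
    rw [mu_eq_restrict_punctured]
    exact ((locallyACOn_varSol hb hab hg).continuousOn isOpen_punctured).aestronglyMeasurable
      isOpen_punctured.measurableSet
  refine ⟨(memLp_two_iff_integrable_sq_norm hm).2 h5, ?_⟩
  rw [h6, (integrable_mu_of_halves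
    (memLp_restrict_of_mu hg Ioo_zero_pi_subset).norm.integrable_sq
    (memLp_restrict_of_mu hgn Ioo_zero_pi_subset).norm.integrable_sq).2, mul_add]
  exact add_le_add h4 h2

theorem norm_sq_eq_integral (u : H) : ‖u‖ ^ 2 = ∫ x, ‖u x‖ ^ 2 ∂mu := by
  have h := @inner_self_eq_norm_sq ℂ H _ _ _ u
  rw [← h, L2.inner_def, ← integral_re (L2.integrable_inner u u)]
  refine integral_congr_ae (Filter.Eventually.of_forall fun x => ?_)
  exact inner_self_eq_norm_sq (𝕜 := ℂ) (u x)

theorem exists_mem_graphM {a b : ℝ} (hb : 0 < b) (hab : |a + b / 2| < 1) (u : H) :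
    ∃ y : H, (y, u) ∈ graphM a b ∧
      ‖y‖ ^ 2 ≤ 3 / (2 * (1 - |a + b / 2|) ^ 2) * ‖u‖ ^ 2 := by
  have hu := Lp.memLp u
  obtain ⟨h1, h2⟩ := varSol_memLp hb hab hu
  refine ⟨h1.toLp, ⟨varSol a b u, locallyACOn_varSol hb hab hu, h1.coeFn_toLp,
    flux_varSol hb hab hu⟩, ?_⟩
  rw [norm_sq_eq_integral, norm_sq_eq_integral]
  refine le_trans (le_of_eq (integral_congr_ae ?_)) h2
  filter_upwards [h1.coeFn_toLp] with x hx
  rw [hx]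

/-! ### Uniqueness and the bounded inverse of `M` -/

theorem eq_const_mul_homSol {f : ℝ → ℂ} {a b p q : ℝ} (hb : 0 < b) (hpq : Ioo p q ⊆ punctured)
    (hf : LocallyACOn f (Ioo p q)) (h : ∀ᵐ x, x ∈ Ioo p q → flux a b f x = 0) :
    ∃ k : ℂ, ∀ x ∈ Ioo p q, f x = k * (homSol a b x : ℂ) := by
  rcases le_or_gt q p with hle | hlt
  · exact ⟨0, fun x hx => absurd (hx.1.trans hx.2) hle.not_gt⟩
  obtain ⟨m, hm⟩ := nonempty_Ioo.2 hlt
  have hne : ∀ x ∈ punctured, (homSol a b x : ℂ) ≠ 0 := fun x hx => by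
    exact_mod_cast (homSol_pos a b hx).ne'
  -- The quotient of two solutions of the homogeneous equation has zero derivative almost
  -- everywhere, hence is constant.
  set r : ℝ → ℂ := fun x => f x * ((homSol a b x)⁻¹ : ℝ) with hr
  have hrac : LocallyACOn r (Ioo p q) := fun c d hcd hs => by
    refine ac_mul (hf c d hcd hs) (ac_ofReal ?_)
    refine ContDiffOn.absolutelyContinuousOnInterval (ContDiffOn.inv ?_ fun x hx => ?_)
    · refine (contDiffOn_homSol a b).mono ?_
      rw [uIcc_of_le hcd]; exact hs.trans hpq
    · rw [uIcc_of_le hcd] at hx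
      exact (homSol_pos a b (hpq (hs hx))).ne'
  have hr0 : ∀ᵐ x, x ∈ Ioo p q → deriv r x = 0 := by
    filter_upwards [h, ae_differentiable_of_locallyACOn_Ioo hf] with x h1 h2 hx
    have hw := (homSol_pos a b (hpq hx)).ne'
    have hd := (h2 hx).hasDerivAt.mul
      ((hasDerivAt_homSol a hb (hpq hx)).inv hw).ofReal_comp
    rw [show deriv r x = _ from hd.deriv]
    have hs : (Real.sin x : ℂ) ≠ 0 := by exact_mod_cast sin_ne_zero_of_mem_punctured (hpq hx)
    have hb' : (b : ℂ) ≠ 0 := by exact_mod_cast hb.ne'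
    have hw' := hne x (hpq hx)
    have h3 := h1 hx
    simp only [flux, Pi.inv_apply] at h3 ⊢
    push_cast at h3 hs ⊢
    field_simp
    linear_combination h3
  refine ⟨r m, fun x hx => ?_⟩
  have h4 := locallyACOn_eq_add_integral hrac (D := 0) IntervalIntegrable.zero hr0 hm hx
  simp only [Pi.zero_apply, intervalIntegral.integral_zero, add_zero] at h4
  rw [← h4, hr]
  dsimp only
  rw [Complex.ofReal_inv, inv_mul_cancel_right₀ (hne x (hpq hx))]

/-- On a half interval `f = k · homSol`, and `homSol²` dominates `1 / |x|` near `0`; square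
integrability forces `k = 0`. The sign of `d` selects the half. -/
theorem eq_zero_of_flux_eq_zero {f : ℝ → ℂ} {a b d : ℝ} (hb : 0 < b) (hab : |a + b / 2| < 1)
    (hd0 : d ≠ 0) (hd : |d| ≤ Real.pi) (hf : LocallyACOn f punctured)
    (h : flux a b f =ᵐ[mu] 0) (hf2 : MemLp f 2 mu) : EqOn f 0 (uIoo 0 d) := by
  have hpi := Real.pi_pos
  have hpun : uIoo 0 d ⊆ punctured := by
    rcases lt_or_gt_of_ne hd0 with h | h
    · rw [uIoo_of_ge h.le]
      rw [abs_of_neg h] at hd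
      exact fun x hx => Or.inl ⟨by linarith [hx.1], hx.2⟩
    · rw [uIoo_of_le h.le]
      rw [abs_of_pos h] at hd
      exact fun x hx => Or.inr ⟨hx.1, by linarith [hx.2]⟩
  have hae : ∀ᵐ x, x ∈ uIoo 0 d → flux a b f x = 0 := by
    rw [Filter.EventuallyEq, ae_restrict_iff' measurableSet_Ioo] at h
    filter_upwards [h] with x hx hm using hx (punctured_subset (hpun hm))
  obtain ⟨k, hk⟩ := eq_const_mul_homSol hb hpun (hf.mono hpun) hae
  by_cases hk0 : k = 0
  · intro x hx
    rw [hk x hx, hk0, zero_mul]; rfl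
  exfalso
  -- Passing to `d / 4` keeps `|x| < π / 2`, the range of the lower bound on `homSol²`, and stays
  -- away from `d`.
  have hmem : ∀ x ∈ uIoc 0 (d / 4), x ≠ 0 → x ∈ uIoo 0 d ∧ |x| < Real.pi / 2 := by
    intro x hx hx0
    rcases lt_or_gt_of_ne hd0 with h | h
    · rw [abs_of_neg h] at hd
      rw [uIoc_of_ge (by linarith)] at hx
      rw [uIoo_of_ge h.le, abs_of_nonpos hx.2]
      exact ⟨⟨by linarith [hx.1], lt_of_le_of_ne hx.2 hx0⟩, by linarith [hx.1]⟩
    · rw [abs_of_pos h] at hd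
      rw [uIoc_of_le (by linarith)] at hx
      rw [uIoo_of_le h.le, abs_of_pos hx.1]
      exact ⟨⟨hx.1, by linarith [hx.2]⟩, by linarith [hx.2]⟩
  have hne : ∀ᵐ x : ℝ, x ≠ 0 := by simp [ae_iff, measure_singleton]
  refine not_ae_inv_le (c := 0) (d := d / 4) (z := fun x => ‖f x‖ ^ 2) (C := (‖k‖ ^ 2)⁻¹)
    (by positivity) ?_ ?_
  · rw [intervalIntegrable_iff]
    have h3 : IntegrableOn (fun x => ‖f x‖ ^ 2) (uIoc 0 (d / 4) ∩ {0}ᶜ) :=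
      (memLp_restrict_of_mu hf2 fun x hx =>
        punctured_subset (hpun (hmem x hx.1 hx.2).1)).norm.integrable_sq
    refine h3.congr_set_ae ?_
    filter_upwards [hne] with x hx
    exact propext ⟨fun h => ⟨h, hx⟩, fun h => h.1⟩
  · filter_upwards [hne] with x hx0 hx
    obtain ⟨h1, h2⟩ := hmem x hx hx0
    have hk1 : 0 < ‖k‖ := norm_pos_iff.2 hk0
    rw [hk x h1, norm_mul, mul_pow, inv_mul_cancel_left₀ (by positivity), sub_zero,
      Complex.norm_real, Real.norm_eq_abs, sq_abs]
    exact inv_abs_le_homSol_sq hb hab hx0 h2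

theorem eq_zero_of_mem_graphM {a b : ℝ} (hb : 0 < b) (hab : |a + b / 2| < 1) {y : H}
    (h : (y, 0) ∈ graphM a b) : y = 0 := by
  obtain ⟨f, hf, h1, h2⟩ := h
  have hpi := Real.pi_pos
  have hf2 : MemLp f 2 mu := (memLp_congr_ae h1).1 (Lp.memLp y)
  have hfl : flux a b f =ᵐ[mu] 0 := h2.symm.trans (Lp.coeFn_zero _ _ _)
  have e1 := eq_zero_of_flux_eq_zero hb hab hpi.ne' (abs_of_pos hpi).le hf hfl hf2
  have e2 := eq_zero_of_flux_eq_zero (d := -Real.pi) hb hab (by linarith)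
    (by rw [abs_neg, abs_of_pos hpi]) hf hfl hf2
  rw [uIoo_of_le hpi.le] at e1
  rw [uIoo_of_ge (by linarith)] at e2
  refine Lp.eq_zero_iff_ae_eq_zero.2 (h1.trans ?_)
  filter_upwards [ae_mem_punctured] with x hx
  exact hx.elim (fun h => e2 h) fun h => e1 h

/-- `graphM` is the graph of the inverse of a bounded operator. -/
theorem exists_clm_graphM {a b : ℝ} (hb : 0 < b) (hab : |a + b / 2| < 1) :
    ∃ B : H →L[ℂ] H, ∀ y u : H, (y, u) ∈ graphM a b ↔ y = B u := by
  choose B hB hBn using exists_mem_graphM hb hab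
  have huniq : ∀ y u : H, (y, u) ∈ graphM a b ↔ y = B u := by
    refine fun y u => ⟨fun h => ?_, fun h => h ▸ hB u⟩
    have := (graphM a b).sub_mem h (hB u)
    rw [Prod.mk_sub_mk, sub_self] at this
    exact sub_eq_zero.1 (eq_zero_of_mem_graphM hb hab this)
  have hc : 0 < 1 - |a + b / 2| := by linarith
  set K := 3 / (2 * (1 - |a + b / 2|) ^ 2)
  let T : H →ₗ[ℂ] H :=
    { toFun := B
      map_add' := fun u v => ((huniq _ _).1 ((graphM a b).add_mem (hB u) (hB v))).symm
      map_smul' := fun k u => ((huniq _ _).1 ((graphM a b).smul_mem k (hB u))).symm }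
  refine ⟨T.mkContinuous (√K) fun u => ?_, huniq⟩
  refine abs_le_of_sq_le_sq' ?_ (by positivity) |>.2
  rw [mul_pow, Real.sq_sqrt (by positivity)]
  exact hBn u

/-! ### Primitives and the graph of `S` -/

theorem neg_pi_le_pi : -Real.pi ≤ Real.pi := by linarith [Real.pi_pos]

theorem intervalIntegrable_of_memLp {g : ℝ → ℂ} (hg : MemLp g 2 mu) :
    IntervalIntegrable g volume (-Real.pi) Real.pi := by
  rw [intervalIntegrable_iff_integrableOn_Ioo_of_le neg_pi_le_pi]
  exact hg.integrable one_le_two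

theorem memLp_of_ac {F : ℝ → ℂ} (hF : AbsolutelyContinuousOnInterval F (-Real.pi) Real.pi) :
    MemLp F 2 mu := by
  obtain ⟨C, hC⟩ := hF.exists_bound
  refine MemLp.of_bound ((ac_continuousOn_Ioo hF).aestronglyMeasurable measurableSet_Ioo) C ?_
  filter_upwards [ae_restrict_mem measurableSet_Ioo] with x hx
  refine hC x ?_
  rw [uIcc_of_le neg_pi_le_pi]
  exact Ioo_subset_Icc_self hx

theorem ae_Icc_of_ae_mu {P : ℝ → Prop} (h : ∀ᵐ x ∂mu, P x) :
    ∀ᵐ x : ℝ, x ∈ uIcc (-Real.pi) Real.pi → P x := by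
  rw [ae_restrict_iff' measurableSet_Ioo] at h
  have hne : ∀ y : ℝ, ∀ᵐ x : ℝ, x ≠ y := fun y => by simp [ae_iff, measure_singleton]
  filter_upwards [h, hne Real.pi, hne (-Real.pi)] with x hx h1 h2 hm
  rw [uIcc_of_le neg_pi_le_pi] at hm
  exact hx ⟨lt_of_le_of_ne hm.1 h2.symm, lt_of_le_of_ne hm.2 h1⟩

/-- The primitive of `g` that vanishes at `-π`. -/
noncomputable def primitive (g : ℝ → ℂ) (x : ℝ) : ℂ := ∫ t in (-Real.pi)..x, g t

theorem ac_primitive {g : ℝ → ℂ} (hg : MemLp g 2 mu) :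
    AbsolutelyContinuousOnInterval (primitive g) (-Real.pi) Real.pi :=
  ac_intervalIntegral (intervalIntegrable_of_memLp hg) left_mem_uIcc

theorem integral_norm_sq_le (u : H) : (∫ x, ‖u x‖ ∂mu) ^ 2 ≤ mu.real univ * ‖u‖ ^ 2 := by
  have := integral_mul_sq_le (ν := mu) (h := fun _ => (1 : ℝ)) (fun x => norm_nonneg (u x))
    (Filter.Eventually.of_forall fun _ => zero_le_one) (Lp.memLp u).norm (memLp_const 1)
  simpa [norm_sq_eq_integral, mul_comm] using this

theorem norm_primitive_le {u : ℝ → ℂ} (hu : MemLp u 2 mu) {x : ℝ}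
    (hx : x ∈ Ioo (-Real.pi) Real.pi) : ‖primitive u x‖ ≤ ∫ t, ‖u t‖ ∂mu := by
  refine (intervalIntegral.norm_integral_le_integral_norm hx.1.le).trans ?_
  rw [intervalIntegral.integral_of_le hx.1.le]
  exact setIntegral_mono_set (hu.integrable one_le_two).norm
    (Filter.Eventually.of_forall fun t => norm_nonneg _)
    (LE.le.eventuallyLE fun t ht => ⟨ht.1, ht.2.trans_lt hx.2⟩)

theorem primitive_pi (g : ℝ → ℂ) : primitive g Real.pi = ∫ t, g t ∂mu := by
  rw [primitive, intervalIntegral.integral_of_le neg_pi_le_pi, integral_Ioc_eq_integral_Ioo]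

/-- The primitive vanishing at `-π`, as a bounded operator. -/
theorem exists_clm_primitive : ∃ K : H →L[ℂ] H, ∀ u : H, K u =ᵐ[mu] primitive u := by
  have hP := fun u : H => memLp_of_ac (ac_primitive (Lp.memLp u))
  have hmem : ∀ᵐ x ∂mu, x ∈ Ioo (-Real.pi) Real.pi := ae_restrict_mem measurableSet_Ioo
  have hint : ∀ (u : H) {x : ℝ}, x ∈ Ioo (-Real.pi) Real.pi →
      IntervalIntegrable u volume (-Real.pi) x := fun u x hx =>
    (intervalIntegrable_of_memLp (Lp.memLp u)).mono_set (by
      rw [uIcc_of_le neg_pi_le_pi, uIcc_of_le hx.1.le]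
      exact Icc_subset_Icc_right hx.2.le)
  have hcongr : ∀ {f g : ℝ → ℂ}, f =ᵐ[mu] g → ∀ x ∈ Ioo (-Real.pi) Real.pi,
      primitive f x = primitive g x := fun {f g} h x hx => by
    refine intervalIntegral.integral_congr_ae ?_
    filter_upwards [ae_Icc_of_ae_mu h] with t ht hm
    rw [uIoc_of_le hx.1.le] at hm
    refine ht ?_
    rw [uIcc_of_le neg_pi_le_pi]
    exact ⟨hm.1.le, hm.2.trans hx.2.le⟩
  let T : H →ₗ[ℂ] H :=
    { toFun := fun u => (hP u).toLp
      map_add' := fun u v => by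
        refine Lp.ext ?_
        filter_upwards [(hP (u + v)).coeFn_toLp, (hP u).coeFn_toLp, (hP v).coeFn_toLp,
          Lp.coeFn_add (hP u).toLp (hP v).toLp, hmem] with x h1 h2 h3 h4 hx
        rw [h1, h4, Pi.add_apply, h2, h3, hcongr (Lp.coeFn_add u v) x hx]
        exact intervalIntegral.integral_add (hint u hx) (hint v hx)
      map_smul' := fun k u => by
        refine Lp.ext ?_
        filter_upwards [(hP (k • u)).coeFn_toLp, (hP u).coeFn_toLp,
          Lp.coeFn_smul k (hP u).toLp, hmem] with x h1 h2 h3 hx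
        rw [RingHom.id_apply, h1, h3, Pi.smul_apply, h2, hcongr (Lp.coeFn_smul k u) x hx]
        exact intervalIntegral.integral_smul k _ }
  -- The primitive is bounded pointwise by the `L¹` norm of `u`. Cauchy–Schwarz and then integration
  -- of the square each contribute a factor `mu.real univ` to the squared norm.
  refine ⟨T.mkContinuous (mu.real univ) fun u => ?_, fun u => (hP u).coeFn_toLp⟩
  refine abs_le_of_sq_le_sq' ?_ (by positivity) |>.2
  have h1 : ‖T u‖ ^ 2 ≤ ∫ _, mu.real univ * ‖u‖ ^ 2 ∂mu := by
    rw [norm_sq_eq_integral]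
    refine integral_mono_ae (Lp.memLp _).norm.integrable_sq (integrable_const _) ?_
    filter_upwards [(hP u).coeFn_toLp, hmem] with x h2 hx
    refine le_trans ?_ (integral_norm_sq_le u)
    rw [show (T u : ℝ → ℂ) x = _ from h2]
    gcongr
    exact norm_primitive_le (Lp.memLp u) hx
  rw [integral_const, smul_eq_mul] at h1
  rw [mul_pow, sq (mu.real univ), mul_assoc]
  exact h1

/-- The constant function `1` as an element of `L²(-π, π)`. -/
noncomputable def oneH : H := (memLp_const (1 : ℂ)).toLp

theorem oneH_coe : oneH =ᵐ[mu] fun _ => (1 : ℂ) := (memLp_const (1 : ℂ)).coeFn_toLp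

theorem exists_clm_integral : ∃ J : H →L[ℂ] ℂ, ∀ u : H, J u = ∫ x, u x ∂mu := by
  refine ⟨innerSL ℂ oneH, fun u => ?_⟩
  rw [innerSL_apply_apply, L2.inner_def]
  refine integral_congr_ae ?_
  filter_upwards [oneH_coe] with x hx
  rw [hx]
  simp

/-- A function in the domain of `S` is a constant plus the primitive of its derivative, and equality
of its end values says that this derivative has integral zero. -/
theorem exists_clm_graphS : ∃ (J : H →L[ℂ] ℂ) (K : H →L[ℂ] H), ∀ u g : H,
    (u, g) ∈ graphS ↔ J g = 0 ∧ ∃ k : ℂ, u = k • oneH + K g := by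
  obtain ⟨J, hJ⟩ := exists_clm_integral
  obtain ⟨K, hK⟩ := exists_clm_primitive
  refine ⟨J, K, fun u g => ⟨?_, ?_⟩⟩
  · rintro ⟨f, hf, h1, h2⟩
    dsimp only at h1 h2
    have hg := Lp.memLp g
    have key : ∀ y ∈ uIcc (-Real.pi) Real.pi, f y = f (-Real.pi) + primitive g y := fun y hy =>
      ac_eq_add_integral hf.1 (intervalIntegrable_of_memLp hg)
        (ae_Icc_of_ae_mu (h2.mono fun x hx => hx.symm)) left_mem_uIcc hy
    refine ⟨?_, f (-Real.pi), Lp.ext ?_⟩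
    · have := key Real.pi right_mem_uIcc
      rw [hf.2, primitive_pi] at this
      rw [hJ]
      simpa using this
    · filter_upwards [h1, hK g, Lp.coeFn_add (f (-Real.pi) • oneH) (K g),
        Lp.coeFn_smul (f (-Real.pi)) oneH, oneH_coe, ae_restrict_mem measurableSet_Ioo]
        with x e1 e2 e3 e4 e5 hx
      rw [e1, e3, Pi.add_apply, e4, Pi.smul_apply, e5, e2, smul_eq_mul, mul_one]
      refine key x ?_
      rw [uIcc_of_le neg_pi_le_pi]
      exact Ioo_subset_Icc_self hx
  · rintro ⟨h0, k, rfl⟩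
    have hg := Lp.memLp g
    refine ⟨fun x => k + primitive g x, ⟨?_, ?_⟩, ?_, ?_⟩
    · exact (ac_congr (g := fun _ => k) (LipschitzOnWith.absolutelyContinuousOnInterval
        (LipschitzWith.const k).lipschitzOnWith) fun _ _ => rfl).add (ac_primitive hg)
    · dsimp only
      rw [primitive_pi, ← hJ, h0, primitive, intervalIntegral.integral_same]
    · filter_upwards [hK g, Lp.coeFn_add (k • oneH) (K g),
        Lp.coeFn_smul k oneH, oneH_coe] with x e2 e3 e4 e5
      rw [e3, Pi.add_apply, e4, Pi.smul_apply, e5, e2, smul_eq_mul, mul_one]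
    · filter_upwards [ae_restrict_of_ae (intervalIntegrable_of_memLp hg).ae_hasDerivAt_integral,
        ae_restrict_mem measurableSet_Ioo] with x hx hm
      have hm' : x ∈ uIcc (-Real.pi) Real.pi := by
        rw [uIcc_of_le neg_pi_le_pi]; exact Ioo_subset_Icc_self hm
      exact ((hx hm' _ left_mem_uIcc).const_add k).deriv.symm

/-! ### Boundary behaviour and the factorization `L = SM` -/

theorem mem_graph_prodOp (T R : H →ₗ.[ℂ] H) (y g : H) :
    (y, g) ∈ (prodOp T R).graph ↔ ∃ u, (y, u) ∈ R.graph ∧ (u, g) ∈ T.graph := by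
  simp only [LinearPMap.mem_graph_iff]
  constructor
  · rintro ⟨⟨_, z, hz, rfl⟩, rfl, rfl⟩
    exact ⟨R z, ⟨z, rfl, rfl⟩, ⟨R z, hz⟩, rfl, rfl⟩
  · rintro ⟨_, ⟨z, rfl, rfl⟩, ⟨w, hw, rfl⟩⟩
    have hm : R z ∈ T.domain := hw ▸ w.2
    refine ⟨⟨z, z, hm, rfl⟩, rfl, ?_⟩
    obtain ⟨w, hw'⟩ := w
    dsimp only at hw
    subst hw
    rfl

/-- At a zero `d` of the sine, `|sin (x - d)| = |sin x|`. -/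
theorem abs_sin_le_abs_sub {x d : ℝ} (hd : Real.sin d = 0) : |Real.sin x| ≤ |x - d| := by
  have h := Real.sin_sq_add_cos_sq d
  have hc : |Real.cos d| = 1 := by
    rw [hd] at h
    rw [← sq_eq_sq₀ (abs_nonneg _) zero_le_one, sq_abs]
    linarith
  have := Real.abs_sin_le_abs (x := x - d)
  rwa [Real.sin_sub, hd, mul_zero, sub_zero, abs_mul, hc, mul_one] at this

/-- An absolutely continuous function dominated by an integrable multiple of `sin` vanishes at the
end points. -/
theorem eq_primitive_of_norm_le_sin {v R z : ℝ → ℂ} {d : ℝ} (hd : d ≠ 0)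
    (hsin : Real.sin d = 0) (hv : LocallyACOn v (uIoo 0 d)) (hR : IntervalIntegrable R volume 0 d)
    (hz : IntervalIntegrable z volume 0 d) (hder : ∀ᵐ x, x ∈ uIoo 0 d → deriv v x = R x)
    (hle : ∀ x ∈ uIoo 0 d, ‖v x‖ ≤ |Real.sin x| * ‖z x‖) :
    (∀ x ∈ uIoo 0 d, v x = ∫ t in (0 : ℝ)..x, R t) ∧ ∫ t in (0 : ℝ)..d, R t = 0 := by
  have hR' : IntervalIntegrable R volume (min 0 d) (max 0 d) :=
    hR.mono_set (by rw [uIcc_of_le min_le_max, uIcc])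
  have hsub : uIoo 0 d ⊆ uIcc 0 d := Ioo_subset_Icc_self
  have hprim : ContinuousOn (fun x => ∫ t in (0 : ℝ)..x, R t) (uIcc 0 d) :=
    (ac_intervalIntegral hR left_mem_uIcc).continuousOn
  obtain ⟨m, hm⟩ : (uIoo 0 d).Nonempty := by
    rw [uIoo, nonempty_Ioo]
    rcases lt_or_gt_of_ne hd with h | h
    · rwa [min_eq_right h.le, max_eq_left h.le]
    · rwa [min_eq_left h.le, max_eq_right h.le]
  obtain ⟨k, hk⟩ : ∃ k, ∀ x ∈ uIoo 0 d, v x = k + ∫ t in (0 : ℝ)..x, R t := by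
    refine ⟨v m - ∫ t in (0 : ℝ)..m, R t, fun x hx => ?_⟩
    rw [locallyACOn_eq_add_integral hv hR' hder hm hx,
      ← intervalIntegral.integral_interval_sub_left (hR.mono_set (uIcc_subset_uIcc_left (hsub hx)))
        (hR.mono_set (uIcc_subset_uIcc_left (hsub hm)))]
    ring
  have hc : ContinuousOn (fun x => k + ∫ t in (0 : ℝ)..x, R t) (uIcc 0 d) :=
    continuousOn_const.add hprim
  have hbd : ∀ {e : ℝ}, Real.sin e = 0 → ∀ x ∈ uIoo 0 d,
      ‖k + ∫ t in (0 : ℝ)..x, R t‖ ≤ 1 * |x - e| * ‖z x‖ := fun he x hx => by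
    rw [← hk x hx, one_mul]
    exact (hle x hx).trans
      (mul_le_mul_of_nonneg_right (abs_sin_le_abs_sub he) (norm_nonneg _))
  -- The continuous extension of `v` is at most `|x - e| ‖z x‖` for either end point `e`, so it
  -- vanishes at both; at `0` this gives `k = 0`.
  have e0 := eq_zero_of_norm_le_mul (C := 1) hd.symm (hc 0 left_mem_uIcc) hz
    (Filter.Eventually.of_forall (hbd Real.sin_zero))
  have hk0 : k = 0 := by simpa using e0
  have e1 := eq_zero_of_norm_le_mul (C := 1) hd (uIcc_comm d 0 ▸ hc d right_mem_uIcc) hz.symm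
    (Filter.Eventually.of_forall fun x hx => hbd hsin x (uIoo_comm d 0 ▸ hx))
  rw [hk0, zero_add] at e1
  refine ⟨fun x hx => ?_, e1⟩
  rw [hk x hx, hk0, zero_add]

theorem one_sub_mul_cos_pos {a : ℝ} (ha : |a| < 1) (x : ℝ) : 0 < 1 - a * Real.cos x := by
  linarith [le_one_sub_mul_cos a x]

theorem ac_of_contDiff {f : ℝ → ℝ} (hf : ContDiff ℝ 1 f) (p q : ℝ) :
    AbsolutelyContinuousOnInterval (fun x => (f x : ℂ)) p q :=
  ac_ofReal hf.contDiffOn.absolutelyContinuousOnInterval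

theorem flux_congr_of_eqOn {f g : ℝ → ℂ} (a b : ℝ) {U : Set ℝ} (hU : IsOpen U) (h : EqOn f g U)
    {x : ℝ} (hx : x ∈ U) : flux a b f x = flux a b g x := by
  have : f =ᶠ[nhds x] g := by filter_upwards [hU.mem_nhds hx] with z hz using h hz
  rw [flux, flux, this.deriv_eq, h hx]

/-- The flux of a function in the domain of `opL` satisfies the periodic boundary condition. -/
theorem flux_periodic {f F : ℝ → ℂ} {a b : ℝ} (hf : PeriodicAC f)
    (hF : AbsolutelyContinuousOnInterval F (-Real.pi) Real.pi) (h : F =ᵐ[mu] flux a b f) :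
    F (-Real.pi) = F Real.pi := by
  have hpi := Real.pi_pos
  set P : ℝ → ℝ := fun x => 1 - a * Real.cos x with hP
  -- Almost everywhere `E = b sin · f'`, and `f'` is integrable, so `E` vanishes at `±π`. There `F`
  -- equals `(1 + a) f`, and periodicity of `f` passes to `F`.
  set E : ℝ → ℂ := fun x => F x - (P x : ℂ) * f x with hE
  have hEac : AbsolutelyContinuousOnInterval E (-Real.pi) Real.pi :=
    hF.sub (ac_mul (ac_of_contDiff (by fun_prop) _ _) hf.1)
  have hEle : ∀ {e : ℝ}, Real.sin e = 0 → ∀ᵐ x, x ∈ uIcc (-Real.pi) Real.pi →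
      ‖E x‖ ≤ |b| * |x - e| * ‖deriv f x‖ := fun {e} he => by
    filter_upwards [ae_Icc_of_ae_mu h] with x hx hm
    rw [hE]
    dsimp only
    rw [hx hm, flux, add_sub_cancel_left, norm_mul, Complex.norm_real, Real.norm_eq_abs, abs_mul]
    exact mul_le_mul_of_nonneg_right
      (mul_le_mul_of_nonneg_left (abs_sin_le_abs_sub he) (abs_nonneg _)) (norm_nonneg _)
  have hint := ac_intervalIntegrable_deriv hf.1
  have e1 : E Real.pi = 0 := by
    refine eq_zero_of_norm_le_mul (C := |b|) (d := -Real.pi) (by linarith) ?_ hint.symm ?_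
    · rw [uIcc_comm]; exact hEac.continuousOn _ right_mem_uIcc
    · filter_upwards [hEle Real.sin_pi] with x hx hm
      rw [uIoo_comm] at hm
      exact hx (Ioo_subset_Icc_self hm)
  have e2 : E (-Real.pi) = 0 := by
    refine eq_zero_of_norm_le_mul (C := |b|) (d := Real.pi) (by linarith) ?_ hint ?_
    · exact hEac.continuousOn _ left_mem_uIcc
    · filter_upwards [hEle (e := -Real.pi) (by simp)] with x hx hm
      exact hx (Ioo_subset_Icc_self hm)
  rw [hE] at e1 e2
  dsimp only [P] at e1 e2
  rw [Real.cos_neg, hf.2] at e2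
  rw [sub_eq_zero.1 e1, sub_eq_zero.1 e2]

theorem exists_factor_of_mem_graphL {a b : ℝ} {y g : H} (h : (y, g) ∈ graphL a b) :
    ∃ u, (y, u) ∈ graphM a b ∧ (u, g) ∈ graphS := by
  obtain ⟨f, F, hf, h1, hF, h2, h3⟩ := h
  have hF2 := memLp_of_ac hF
  exact ⟨hF2.toLp, ⟨f, hf.locallyACOn, h1, hF2.coeFn_toLp.trans h2⟩,
    ⟨F, ⟨hF, flux_periodic hf hF h2⟩, hF2.coeFn_toLp, h3⟩⟩

theorem memLp_ofReal_mul {g : ℝ → ℂ} {r : ℝ → ℝ} (hg : MemLp g 2 mu) (hr : Continuous r) :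
    MemLp (fun x => (r x : ℂ) * g x) 2 mu := by
  obtain ⟨C, hC⟩ := isCompact_Icc.exists_bound_of_continuousOn (s := Icc (-Real.pi) Real.pi)
    hr.continuousOn
  refine hg.of_le_mul (c := C)
    ((Complex.continuous_ofReal.comp hr).aestronglyMeasurable.mul hg.1) ?_
  filter_upwards [ae_restrict_mem measurableSet_Ioo] with x hx
  rw [norm_mul, Complex.norm_real]
  gcongr
  exact hC x (Ioo_subset_Icc_self hx)

/-- `sin · z` is a periodic absolutely continuous function whenever `z` is square integrable and
`(1 - k cos x) z + b sin x · z'` is square integrable. -/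
theorem sin_mul_periodicAC {z w : ℝ → ℂ} {k b : ℝ} (hb : 0 < b) (hz : LocallyACOn z punctured)
    (hz2 : MemLp z 2 mu) (hw : MemLp w 2 mu) (h : w =ᵐ[mu] flux k b z) :
    ∃ V : ℝ → ℂ, PeriodicAC V ∧ EqOn V (fun x => (Real.sin x : ℂ) * z x) punctured := by
  have hpi := Real.pi_pos
  set v : ℝ → ℂ := fun x => (Real.sin x : ℂ) * z x with hv
  have hvac : LocallyACOn v punctured := fun c d hcd hs =>
    ac_mul (ac_of_contDiff Real.contDiff_sin _ _) (hz c d hcd hs)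
  -- `R` is `(sin · z)'` with `z'` eliminated by the equation; in this form it is visibly square
  -- integrable.
  set R : ℝ → ℂ := fun x =>
    (b : ℂ)⁻¹ * (w x - ((1 - (k + b) * Real.cos x : ℝ) : ℂ) * z x) with hR
  have hR2 : MemLp R 2 mu := (hw.sub (memLp_ofReal_mul hz2 (by fun_prop))).const_mul _
  have hb' : (b : ℂ) ≠ 0 := by exact_mod_cast hb.ne'
  have hder : ∀ᵐ x ∂mu, deriv v x = R x := by
    filter_upwards [h, ae_differentiable_of_locallyACOn hz] with x h1 h2
    have hd := (Real.hasDerivAt_sin x).ofReal_comp.mul h2.hasDerivAt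
    rw [show deriv v x = _ from hd.deriv, hR]
    dsimp only
    rw [h1, flux]
    push_cast
    field_simp
    ring
  have hmain : ∀ d : ℝ, d ≠ 0 → Real.sin d = 0 → uIoo 0 d ⊆ punctured →
      d ∈ uIcc (-Real.pi) Real.pi →
      (∀ x ∈ uIoo 0 d, v x = ∫ t in (0 : ℝ)..x, R t) ∧ ∫ t in (0 : ℝ)..d, R t = 0 := by
    intro d hd0 hsd hsub hd
    have hss : uIcc 0 d ⊆ uIcc (-Real.pi) Real.pi := by
      refine uIcc_subset_uIcc ?_ hd
      rw [uIcc_of_le neg_pi_le_pi]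
      exact ⟨by linarith, hpi.le⟩
    refine eq_primitive_of_norm_le_sin hd0 hsd (hvac.mono hsub)
      ((intervalIntegrable_of_memLp hR2).mono_set hss)
      ((intervalIntegrable_of_memLp hz2).mono_set hss) ?_ fun x _ => ?_
    · filter_upwards [ae_Icc_of_ae_mu hder] with x hx hm
      exact hx (hss (Ioo_subset_Icc_self hm))
    · rw [hv]
      dsimp only
      rw [norm_mul, Complex.norm_real, Real.norm_eq_abs]
  obtain ⟨p1, p2⟩ := hmain Real.pi hpi.ne' Real.sin_pi
    (by rw [uIoo_of_le hpi.le]; exact subset_union_right) right_mem_uIcc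
  obtain ⟨n1, n2⟩ := hmain (-Real.pi) (by linarith) (by simp)
    (by rw [uIoo_of_ge (by linarith)]; exact subset_union_left) left_mem_uIcc
  rw [uIoo_of_le hpi.le] at p1
  rw [uIoo_of_ge (by linarith)] at n1
  -- On both halves `v` is the primitive of `R` from `0`, so one primitive serves across the origin;
  -- it vanishes at `±π`.
  refine ⟨fun x => ∫ t in (0 : ℝ)..x, R t, ⟨?_, ?_⟩, ?_⟩
  · refine ac_intervalIntegral (intervalIntegrable_of_memLp hR2) ?_
    rw [uIcc_of_le neg_pi_le_pi]
    exact ⟨by linarith, hpi.le⟩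
  · dsimp only
    rw [n2, p2]
  · rintro x (hx | hx)
    · exact (n1 x hx).symm
    · exact (p1 x hx).symm

/-- Inserting `G + sin · z` with `G = F / (1 - a cos)` into `flux a b` gives `F + sin · (b G' + flux
(a - b) b z)`. It therefore suffices to solve `flux (a - b) b z = -b G'` in `L²`, and `sin · z` is
then periodic and absolutely continuous. -/
theorem mem_graphL_of_factor {a b : ℝ} (hb : 0 < b) (ha : |a| < 1) (hab : |a + b / 2| < 1)
    (hab' : |a - b / 2| < 1) {y u g : H} (h1 : (y, u) ∈ graphM a b) (h2 : (u, g) ∈ graphS) :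
    (y, g) ∈ graphL a b := by
  obtain ⟨F, hF, hF1, hF2⟩ := h2
  dsimp only at hF1 hF2
  set Q : ℝ → ℝ := fun x => (1 - a * Real.cos x)⁻¹ with hQ
  have hP := one_sub_mul_cos_pos ha
  have hQd : ContDiff ℝ 2 Q := ContDiff.inv (by fun_prop) fun x => (hP x).ne'
  have hQd' : ContDiff ℝ 1 (deriv Q) := by
    have : ContDiff ℝ (1 + 1) Q := by simpa [one_add_one_eq_two] using hQd
    exact (contDiff_succ_iff_deriv.1 this).2.2
  have hQac := ac_of_contDiff (hQd.of_le one_le_two) (-Real.pi) Real.pi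
  set G : ℝ → ℂ := fun x => (Q x : ℂ) * F x with hG
  have hGac : PeriodicAC G := by
    refine ⟨ac_mul hQac hF.1, ?_⟩
    simp only [hG, hQ, Real.cos_neg, hF.2]
  set w : ℝ → ℂ := fun x => (-b : ℂ) * ((Q x : ℂ) * g x + ((deriv Q x : ℝ) : ℂ) * F x) with hw
  have hw2 : MemLp w 2 mu := by
    refine MemLp.const_mul ?_ _
    exact (memLp_ofReal_mul (Lp.memLp g) hQd.continuous).add
      (memLp_ofReal_mul (memLp_of_ac hF.1) hQd'.continuous)
  have hGd : ∀ᵐ x ∂mu, HasDerivAt G ((Q x : ℂ) * g x + ((deriv Q x : ℝ) : ℂ) * F x) x := by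
    filter_upwards [hF2, ae_differentiable_of_ac hF.1] with x e1 e2
    have hq : HasDerivAt Q (deriv Q x) x :=
      (hQd.differentiable (by norm_num) x).hasDerivAt
    refine (hq.ofReal_comp.mul e2.hasDerivAt).congr_deriv ?_
    rw [e1]; ring
  -- Solvability at parameter `a - b`, possibly negative, is why the estimates assume only `|a + b /
  -- 2| < 1` and no sign of `a`.
  obtain ⟨ζ, hζ, -⟩ := exists_mem_graphM (a := a - b) hb
    (by rwa [show a - b + b / 2 = a - b / 2 by ring]) hw2.toLp
  obtain ⟨z, hz, hz1, hz2⟩ := hζ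
  have hwz : w =ᵐ[mu] flux (a - b) b z := hw2.coeFn_toLp.symm.trans hz2
  have hz3 : MemLp z 2 mu := (memLp_congr_ae hz1).1 (Lp.memLp ζ)
  obtain ⟨V, hV, hVe⟩ := sin_mul_periodicAC hb hz hz3 hw2 hwz
  have hYac : PeriodicAC (G + V) := hGac.add hV
  have hflux : F =ᵐ[mu] flux a b (G + V) := by
    filter_upwards [hwz, hGd, ae_differentiable_of_locallyACOn hz, ae_mem_punctured]
      with x e1 e2 e3 hx
    have hcongr := flux_congr_of_eqOn a b (f := G + V)
      (g := fun x => G x + (Real.sin x : ℂ) * z x) isOpen_punctured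
      (fun t ht => by rw [Pi.add_apply, hVe ht]) hx
    have hd := e2.add ((Real.hasDerivAt_sin x).ofReal_comp.mul e3.hasDerivAt)
    rw [hcongr, flux, show deriv (fun x => G x + (Real.sin x : ℂ) * z x) x = _ from hd.deriv]
    have hPQ : ((1 - a * Real.cos x : ℝ) : ℂ) * (Q x : ℂ) = 1 := by
      rw [← Complex.ofReal_mul, hQ]
      dsimp only
      rw [mul_inv_cancel₀ (hP x).ne', Complex.ofReal_one]
    rw [hw, flux] at e1
    dsimp only at e1
    rw [hG]
    dsimp only
    push_cast at e1 hPQ ⊢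
    linear_combination (-F x) * hPQ + (Complex.sin x) * e1
  obtain ⟨B, hB⟩ := exists_clm_graphM hb hab
  have hY2 := memLp_of_ac hYac.1
  have hmem : (hY2.toLp, u) ∈ graphM a b :=
    ⟨G + V, hYac.locallyACOn, hY2.coeFn_toLp, hF1.trans hflux⟩
  -- Both `y` and the constructed function solve `M y = u`, so injectivity of `M` identifies them.
  have hy : y = hY2.toLp := ((hB _ _).1 h1).trans ((hB _ _).1 hmem).symm
  exact ⟨G + V, F, hYac, hy ▸ hY2.coeFn_toLp, hF.1, hflux, hF2⟩

theorem mem_graphL_iff {a b : ℝ} (hb : 0 < b) (ha : |a| < 1) (hab : |a + b / 2| < 1)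
    (hab' : |a - b / 2| < 1) (y g : H) :
    (y, g) ∈ graphL a b ↔ ∃ u, (y, u) ∈ graphM a b ∧ (u, g) ∈ graphS :=
  ⟨exists_factor_of_mem_graphL, fun ⟨_, h1, h2⟩ => mem_graphL_of_factor hb ha hab hab' h1 h2⟩

/-! ### Closedness and bounded invertibility -/

theorem isClosed_opM {a b : ℝ} {B : H →L[ℂ] H}
    (hB : ∀ y u : H, (y, u) ∈ graphM a b ↔ y = B u) : (opM a b).IsClosed := by
  have : ((opM a b).graph : Set (H × H)) = {p | p.1 = B p.2} := by
    ext ⟨y, u⟩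
    rw [SetLike.mem_coe, opM_graph]
    exact hB y u
  rw [LinearPMap.IsClosed, this]
  exact isClosed_eq continuous_fst (by fun_prop)

theorem boundedlyInvertible_opM {a b : ℝ} {B : H →L[ℂ] H}
    (hB : ∀ y u : H, (y, u) ∈ graphM a b ↔ y = B u) : BoundedlyInvertible (opM a b) := by
  refine ⟨B, fun u => ?_, fun y => ?_⟩
  · have h : (B u, u) ∈ (opM a b).graph := by rw [opM_graph]; exact (hB _ _).2 rfl
    obtain ⟨⟨_, hz⟩, rfl, h2⟩ := (LinearPMap.mem_graph_iff _).1 h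
    exact ⟨hz, h2⟩
  · have h := (opM a b).mem_graph y
    rw [opM_graph] at h
    exact ((hB _ _).1 h).symm

end FluidFactorization

theorem theorem1 (a b : ℝ) (ha : 0 < a) (hb : 0 < b) (hab : 2 * a + b < 2) :
    (FluidFactorization.opL a b).IsClosed ∧
      IsClosed (Set.range (FluidFactorization.opL a b)) ∧
      FluidFactorization.opL a b =
        FluidFactorization.prodOp FluidFactorization.opS (FluidFactorization.opM a b) ∧
      (FluidFactorization.opM a b).IsClosed ∧
      FluidFactorization.BoundedlyInvertible (FluidFactorization.opM a b) := by
  have ha1 : |a| < 1 := abs_lt.2 ⟨by linarith, by linarith⟩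
  have hab1 : |a + b / 2| < 1 := abs_lt.2 ⟨by linarith, by linarith⟩
  have hab2 : |a - b / 2| < 1 := abs_lt.2 ⟨by linarith, by linarith⟩
  obtain ⟨B, hB⟩ := FluidFactorization.exists_clm_graphM hb hab1
  obtain ⟨J, K, hS⟩ := FluidFactorization.exists_clm_graphS
  have hL := FluidFactorization.mem_graphL_iff hb ha1 hab1 hab2
  -- Apply `B` to `u = k • oneH + K g`: the free constant of integration becomes a multiple of `B
  -- oneH`. A one-dimensional span is closed, which makes the graph of `L` closed.
  have hL' : ∀ y g, (y, g) ∈ FluidFactorization.graphL a b ↔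
      J g = 0 ∧ y - B (K g) ∈ Submodule.span ℂ {B FluidFactorization.oneH} := by
    intro y g
    rw [hL, Submodule.mem_span_singleton]
    constructor
    · rintro ⟨u, h1, h2⟩
      obtain ⟨hJ, k, rfl⟩ := (hS _ _).1 h2
      refine ⟨hJ, k, ?_⟩
      rw [(hB _ _).1 h1, map_add, map_smul, add_sub_cancel_right]
    · rintro ⟨hJ, k, hk⟩
      refine ⟨k • FluidFactorization.oneH + K g, (hB _ _).2 ?_, (hS _ _).2 ⟨hJ, k, rfl⟩⟩
      rw [map_add, map_smul, hk, sub_add_cancel]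
  refine ⟨?_, ?_, ?_, FluidFactorization.isClosed_opM hB,
    FluidFactorization.boundedlyInvertible_opM hB⟩
  · have : ((FluidFactorization.opL a b).graph :
        Set (FluidFactorization.H × FluidFactorization.H)) = {p | J p.2 = 0} ∩
        (fun p : FluidFactorization.H × FluidFactorization.H => p.1 - B (K p.2)) ⁻¹' (Submodule.span ℂ {B FluidFactorization.oneH}) := by
      ext ⟨y, g⟩
      rw [SetLike.mem_coe, FluidFactorization.opL_graph]
      exact hL' y g
    rw [LinearPMap.IsClosed, this]
    exact (isClosed_eq (by fun_prop) continuous_const).inter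
      ((Submodule.closed_of_finiteDimensional _).preimage (by fun_prop))
  · have : Set.range (FluidFactorization.opL a b) = {g | J g = 0} := by
      ext g
      constructor
      · rintro ⟨y, rfl⟩
        have h := (FluidFactorization.opL a b).mem_graph y
        rw [FluidFactorization.opL_graph] at h
        exact ((hL' _ _).1 h).1
      · intro hg
        have h : (B (K g), g) ∈ (FluidFactorization.opL a b).graph := by
          rw [FluidFactorization.opL_graph]
          exact (hL' _ _).2 ⟨hg, by rw [sub_self]; exact Submodule.zero_mem _⟩
        obtain ⟨z, -, hz⟩ := (LinearPMap.mem_graph_iff _).1 h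
        exact ⟨z, hz⟩
    rw [this]
    exact isClosed_eq (by fun_prop) continuous_const
  · refine LinearPMap.eq_of_eq_graph ?_
    ext ⟨y, g⟩
    rw [FluidFactorization.mem_graph_prodOp, FluidFactorization.opL_graph,
      FluidFactorization.opS_graph, FluidFactorization.opM_graph]
    exact hL y g
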